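/- For separable complex Hilbert spaces $\mathcal H,\mathcal K$ let $H^2_{\rm s}(\mathcal B(\mathcal H,\mathcal K))$ be the space of analytic functions $F$ on the open unit disc with values in the bounded linear operators $\mathcal H\to\mathcal K$ such that $z\mapsto F(z)x$ belongs to the Hardy space $H^2(\mathcal K)$ for every $x\in\mathcal H$. Such an $F$ is called *inner* if its boundary value $F(\zeta)$ (strong radial limit) is an isometry for almost all $\zeta$ on the unit circle; it is called *outer* if the set $\{Fq : q \text{ a polynomial with coefficients in } \mathcal H\}$ is dense in $H^2(\mathcal K)$. Fixing orthonormal bases, we identify operator functions with (possibly infinite) matrix functions; $F$ is called *co-outer* if the transposed function $F^{\rm t}$ belongs to $H^2_{\rm s}(\mathcal B(\mathcal K,\mathcal H))$ and is outer. **Theorem.** Let $d<\infty$ and let $F\in H^2_{\rm s}(\mathcal B(\mathbb C^d,\ell^2))$ be co-outer (with respect to the standard bases). Suppose that $F=\Theta G$ in the unit disc, where, for some separable Hilbert space $\mathcal E$, $\Theta\in H^2_{\rm s}(\mathcal B(\mathcal E,\ell^2))$ is inner and $G\in H^2_{\rm s}(\mathcal B(\mathbb C^d,\mathcal E))$ is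 outer. Then $\Theta$ is co-outer (with respect to any orthonormal basis of $\mathcal E$ and the standard basis of $\ell^2$). -/

import Mathlib

open MeasureTheory Set Filter Topology
open scoped ENNReal lp

noncomputable section

namespace OpHardy

variable {H K : Type*} [NormedAddCommGroup H] [InnerProductSpace ℂ H] [CompleteSpace H]
  [NormedAddCommGroup K] [InnerProductSpace ℂ K] [CompleteSpace K]

/-- Normalized Lebesgue measure on the unit circle, in the coordinate `t ↦ exp (i t)`,
`t ∈ (0, 2π]`. -/
def circleMeasure : Measure ℝ :=
  (ENNReal.ofReal (2 * Real.pi))⁻¹ • volume.restrict (Ioc 0 (2 * Real.pi))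

/-- The Hardy norm `sup_{0 < r < 1} (∫ ‖f (r ζ)‖² dm(ζ))^{1/2}` of a function on the unit disc
(only the values of `f` in the open unit disc matter). -/
def h2Norm (f : ℂ → K) : ℝ≥0∞ :=
  ⨆ r ∈ Ioo (0 : ℝ) 1, eLpNorm (fun t : ℝ => f (circleMap 0 r t)) 2 circleMeasure

/-- `f` belongs to the vector-valued Hardy class `H²(K)` of the unit disc. -/
def MemH2 (f : ℂ → K) : Prop :=
  DifferentiableOn ℂ f (Metric.ball 0 1) ∧ h2Norm f < ∞

/-- `F` belongs to `H²_s(B(H, K))`: it is an analytic operator function on the unit disc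
such that `z ↦ F z x` is in `H²(K)` for every `x ∈ H`. -/
def MemH2s (F : ℂ → H →L[ℂ] K) : Prop :=
  DifferentiableOn ℂ F (Metric.ball 0 1) ∧ ∀ x : H, MemH2 (fun z => F z x)

/-- `F` is inner: its boundary value `F ζ` (the strong radial limit) is an isometry
for almost all `ζ` on the unit circle. -/
def IsInner (F : ℂ → H →L[ℂ] K) : Prop :=
  MemH2s F ∧ ∀ᵐ t ∂circleMeasure, ∃ V : H →ₗᵢ[ℂ] K, ∀ x : H,
    Tendsto (fun r : ℝ => F (circleMap 0 r t) x) (𝓝[<] 1) (𝓝 (V x))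

/-- `q` is a polynomial with coefficients in `H`. -/
def IsPoly (q : ℂ → H) : Prop :=
  ∃ (N : ℕ) (c : ℕ → H), ∀ z, q z = ∑ n ∈ Finset.range N, z ^ n • c n

/-- `F` is outer: the functions `F q`, with `q` an `H`-valued polynomial, are dense in `H²(K)`. -/
def IsOuter (F : ℂ → H →L[ℂ] K) : Prop :=
  MemH2s F ∧ ∀ f : ℂ → K, MemH2 f → ∀ ε : ℝ≥0∞, 0 < ε →
    ∃ q : ℂ → H, IsPoly q ∧ h2Norm (fun z => F z (q z) - f z) < ε

variable {ι κ : Type*}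

/-- Complex conjugation of the coordinates with respect to a Hilbert basis. -/
def conjugation (b : HilbertBasis ι ℂ H) : H ≃ₗᵢ⋆[ℂ] H :=
  (b.repr.trans (starₗᵢ ℂ)).trans b.repr.symm

/-- The operator whose matrix is the transpose of the matrix of `T`, with respect to
the Hilbert bases `b` of `H` and `b'` of `K`. -/
def transpose (b : HilbertBasis ι ℂ H) (b' : HilbertBasis κ ℂ K) (T : H →L[ℂ] K) : K →L[ℂ] H :=
  ((conjugation b).toContinuousLinearEquiv : H →L⋆[ℂ] H).comp
    ((ContinuousLinearMap.adjoint T).comp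
      ((conjugation b').toContinuousLinearEquiv : K →L⋆[ℂ] K))

/-- The matrix of `transpose b b' T` is the transpose of the matrix of `T`. -/
theorem inner_transpose (b : HilbertBasis ι ℂ H) (b' : HilbertBasis κ ℂ K) (T : H →L[ℂ] K)
    (i : ι) (j : κ) : inner ℂ (b i) (transpose b b' T (b' j)) = inner ℂ (b' j) (T (b i)) := by
  classical
  have h1 : conjugation b' (b' j) = b' j := by
    simp only [conjugation, LinearIsometryEquiv.trans_apply]
    rw [LinearIsometryEquiv.symm_apply_eq, b'.repr_self]
    ext k
    by_cases h : k = j <;> simp [h, lp.single_apply]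
  have h2 : ∀ x : H, inner ℂ (b i) (conjugation b x) = star (inner ℂ (b i) x) := by
    intro x
    rw [← b.repr_apply_apply, ← b.repr_apply_apply]
    simp [conjugation]
  have h3 : transpose b b' T (b' j) =
      conjugation b (ContinuousLinearMap.adjoint T (conjugation b' (b' j))) := rfl
  rw [h3, h1, h2, ContinuousLinearMap.adjoint_inner_right]
  exact inner_conj_symm _ _

/-- `F` is co-outer: the transposed (matrix) function is outer. -/
def IsCoOuter (b : HilbertBasis ι ℂ H) (b' : HilbertBasis κ ℂ K) (F : ℂ → H →L[ℂ] K) : Prop :=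
  IsOuter (fun z => transpose b b' (F z))

/-- The standard basis of `ℂ^d`. -/
def stdBasisFin (d : ℕ) : HilbertBasis (Fin d) ℂ (EuclideanSpace ℂ (Fin d)) :=
  (EuclideanSpace.basisFun (Fin d) ℂ).toHilbertBasis

/-- The standard basis of `ℓ²`. -/
def stdBasisEll2 : HilbertBasis ℕ ℂ ℓ²(ℕ, ℂ) :=
  HilbertBasis.ofRepr (LinearIsometryEquiv.refl ℂ _)

end OpHardy

end

noncomputable section

namespace OpHardy

open AddCircle Real

/-! ### The circle, its measure, and subharmonicity for polynomials. -/

section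

/-! Transposing gives `Fᵗ = Gᵗ Θᵗ`. An outer function has dense range at the origin. For `G` this
forces `dim E ≤ d`, and for `Fᵗ`, whose value at `0` factors through `E`, it forces `d ≤ dim E`. So
`Gᵗ` is a square matrix function, and the theorem reduces to a statement about squares
(`isOuter_of_mul`): if `A` is a `d × d` matrix function with `H²` entries and `A B` is outer, then
`B` is outer.

Let `D` be the space of boundary functions of `B q`, `q` a polynomial, and let `M` be its closure in
`L²(ℂ^d)`. It must contain every analytic function (`mem_closure_of_isAnalytic`). Since `A D` is
dense, there are matrices `U_k` with columns in `D` such that the columns of `V_k = A U_k` tend to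
the constant basis vectors. Hence `det V_k(0) → 1`, so evaluation at `0` maps `D` onto `ℂ^d`, and
the wandering subspace `M ⊖ zM` contains `d` orthonormal functions (`exists_wandering`). Let `W` be
the square matrix with these columns. It is unitary almost everywhere on the circle, and `H_k = W*
U_k` is analytic, so `V_k = A W H_k`.

The decisive estimate is `norm_det_evalMatrix_le`. As `|det W| = 1` on the circle, subharmonicity in
`L^{2/d}` applied to `det A · det H_k` gives `|det V_k(0)| ≤ |det W(0)| ‖det V_k‖_{2/d}`, while the
inequality of arithmetic and geometric means bounds `‖det V_k‖_{2/d}^{2/d}` by the mean of the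
squared column norms, which tends to `1`. In the limit, `|det W(0)| ≥ 1`. The same inequality at the
origin gives `|det W(0)| ≤ 1`, with equality only if every column has its full norm in its constant
term. So `W` is a constant invertible matrix, and `M` is everything.

Determinants of `H²` entries lie only in `L^{2/d}`, often with exponent below `1`. `HardyVal`
therefore records boundary values together with the value at `0` for arbitrary positive exponents,
in a form stable under products. -/

instance fact_two_pi_pos : Fact (0 < 2 * π) := ⟨two_pi_pos⟩

/-- The unit circle with its angular coordinate. -/
abbrev Torus : Type := AddCircle (2 * π)

/-- The Haar probability measure of the circle. -/
abbrev haar : Measure Torus := haarAddCircle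

theorem measurePreserving_circleMeasure :
    MeasurePreserving ((↑) : ℝ → Torus) circleMeasure haar := by
  have h := (AddCircle.measurePreserving_mk (2 * π) 0).smul_measure (ENNReal.ofReal (2 * π))⁻¹
  rw [volume_eq_smul_haarAddCircle, smul_smul, ENNReal.inv_mul_cancel
    (by simp [pi_pos]) (by finiteness), one_smul, zero_add] at h
  exact h

instance isProbabilityMeasure_circleMeasure : IsProbabilityMeasure circleMeasure :=
  ⟨by
    simpa using measurePreserving_circleMeasure.measure_preimage
      (MeasurableSet.univ (α := Torus)).nullMeasurableSet⟩

theorem circleMap_eq_fourier (r t : ℝ) : circleMap 0 r t = r * fourier 1 (t : Torus) := by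
  rw [fourier_coe_apply, circleMap]
  have : (π : ℂ) ≠ 0 := by exact_mod_cast pi_ne_zero
  push_cast
  rw [zero_add]
  congr 2
  field_simp

theorem eLpNorm_circleMap {K : Type*} [NormedAddCommGroup K] (f : ℂ → K) (p : ℝ≥0∞) (r : ℝ)
    (hf : AEStronglyMeasurable (fun x : Torus => f (r * fourier 1 x)) haar) :
    eLpNorm (fun t : ℝ => f (circleMap 0 r t)) p circleMeasure =
      eLpNorm (fun x : Torus => f (r * fourier 1 x)) p haar := by
  rw [← eLpNorm_comp_measurePreserving hf measurePreserving_circleMeasure]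
  simp only [Function.comp_def, circleMap_eq_fourier]

theorem integral_circleMeasure (f : ℝ → ℝ) :
    ∫ t, f t ∂circleMeasure = (2 * π)⁻¹ * ∫ t in (0)..(2 * π), f t := by
  rw [circleMeasure, integral_smul_measure, intervalIntegral.integral_of_le two_pi_pos.le,
    ENNReal.toReal_inv, ENNReal.toReal_ofReal two_pi_pos.le, smul_eq_mul]

/-- Subharmonicity of `|P|^q` for a polynomial `P`. -/
theorem enorm_coeff_zero_le_eLpNorm (P : Polynomial ℂ) {q : ℝ} (hq : 0 < q) :
    ‖P.coeff 0‖ₑ ≤ eLpNorm (fun x : Torus => P.eval (fourier 1 x)) (ENNReal.ofReal q) haar := by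
  rcases eq_or_ne P 0 with rfl | hP
  · simp
  have hc : Continuous fun t : ℝ => P.eval (circleMap 0 1 t) :=
    P.continuous.comp (continuous_circleMap 0 1)
  have h1 := eLpNorm_circleMap (fun z => P.eval z) (ENNReal.ofReal q) 1
    (by exact (P.continuous.comp (by fun_prop)).aestronglyMeasurable)
  simp only [Complex.ofReal_one, one_mul] at h1
  rw [← h1]
  obtain ⟨C, hC⟩ : ∃ C, ∀ t : ℝ, ‖P.eval (circleMap 0 1 t)‖ ≤ C := by
    obtain ⟨C, hC⟩ := (isCompact_closedBall (0 : ℂ) 1).exists_bound_of_continuousOn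
      P.continuous.continuousOn
    exact ⟨C, fun t => hC _ (by simp)⟩
  have hm : MemLp (fun t : ℝ => P.eval (circleMap 0 1 t)) (ENNReal.ofReal q) circleMeasure :=
    MemLp.of_bound hc.aestronglyMeasurable C (Eventually.of_forall hC)
  rw [hm.eLpNorm_eq_integral_rpow_norm (by simpa using hq) (by simp),
    ENNReal.toReal_ofReal hq.le, ← ofReal_norm]
  apply ENNReal.ofReal_le_ofReal
  have hne : ∀ᵐ t ∂circleMeasure, P.eval (circleMap 0 1 t) ≠ 0 := by
    have hcount : (circleMap 0 1 ⁻¹' (P.rootSet ℂ)).Countable :=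
      (P.rootSet_finite ℂ).countable.preimage_circleMap 0 one_ne_zero
    have : circleMeasure (circleMap 0 1 ⁻¹' (P.rootSet ℂ)) = 0 := by
      rw [circleMeasure, Measure.smul_apply]
      simp [Measure.restrict_apply hcount.measurableSet,
        (hcount.mono inter_subset_left).measure_zero]
    filter_upwards [measure_eq_zero_iff_ae_notMem.1 this] with t ht h0
    exact ht (by simpa [Polynomial.mem_rootSet, hP] using h0)
  have hint : Integrable (fun t => q * log ‖P.eval (circleMap 0 1 t)‖) circleMeasure := by
    refine Integrable.const_mul ?_ q
    have := (intervalIntegrable_iff_integrableOn_Ioc_of_le two_pi_pos.le).1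
      (Polynomial.intervalIntegrable_mahlerMeasure P)
    exact this.smul_measure (by simp [pi_pos])
  have hexp : ∀ᵐ t ∂circleMeasure, exp (q * log ‖P.eval (circleMap 0 1 t)‖) =
      ‖P.eval (circleMap 0 1 t)‖ ^ q := by
    filter_upwards [hne] with t ht
    rw [rpow_def_of_pos (norm_pos_iff.2 ht), mul_comm]
  have hint2 : Integrable (fun t => ‖P.eval (circleMap 0 1 t)‖ ^ q) circleMeasure := by
    simpa [ENNReal.toReal_ofReal hq.le] using
      hm.integrable_norm_rpow (by simpa using hq) (by simp)
  -- Jensen for `exp`: the geometric mean of `|P|^q` is at most its arithmetic mean.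
  have hJ := convexOn_exp.map_integral_le (μ := circleMeasure)
    continuous_exp.continuousOn isClosed_univ (by simp) hint
    (hint2.congr (by filter_upwards [hexp] with t ht; exact ht.symm))
  rw [integral_congr_ae hexp, integral_const_mul, integral_circleMeasure] at hJ
  -- The Mahler measure is the exponential of the mean of `log |P|`, so this is the subharmonicity
  -- of `log |P|` at the origin.
  have hM := P.norm_coeff_le_choose_mul_mahlerMeasure 0
  rw [Nat.choose_zero_right, Nat.cast_one, one_mul,
    Polynomial.mahlerMeasure_def_of_ne_zero hP] at hM
  refine hM.trans ?_
  rw [mul_comm, exp_mul] at hJ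
  calc _ = (exp ((2 * π)⁻¹ * ∫ t in (0)..(2 * π), log ‖P.eval (circleMap 0 1 t)‖) ^ q) ^ q⁻¹ := by
        rw [rpow_rpow_inv (exp_nonneg _) hq.ne']
    _ ≤ _ := by gcongr

end

/-! ### Boundary functions in `L^p`, `p > 0`, and their values at the origin. -/

section

section Convergence

variable {α ι : Type*} {m : MeasurableSpace α} {μ : Measure α} {l : Filter ι}
  {u v : ι → α → ℂ} {u₀ v₀ : α → ℂ}

theorem eLpNorm_mul_le {f g : α → ℂ} {p q r : ℝ≥0∞} [ENNReal.HolderTriple p q r]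
    (hf : AEStronglyMeasurable f μ) (hg : AEStronglyMeasurable g μ) :
    eLpNorm (fun x => f x * g x) r μ ≤ eLpNorm f p μ * eLpNorm g q μ := by
  simpa using eLpNorm_le_eLpNorm_mul_eLpNorm_of_nnnorm (r := r) hf hg (· * ·) 1
    (Eventually.of_forall fun x => by simp [nnnorm_mul])

theorem tendsto_eLpNorm_add_sub {p : ℝ≥0∞}
    (hu : ∀ i, AEStronglyMeasurable (u i) μ) (hv : ∀ i, AEStronglyMeasurable (v i) μ)
    (hu₀ : AEStronglyMeasurable u₀ μ) (hv₀ : AEStronglyMeasurable v₀ μ)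
    (h₁ : Tendsto (fun i => eLpNorm (fun x => u i x - u₀ x) p μ) l (𝓝 0))
    (h₂ : Tendsto (fun i => eLpNorm (fun x => v i x - v₀ x) p μ) l (𝓝 0)) :
    Tendsto (fun i => eLpNorm (fun x => (u i x + v i x) - (u₀ x + v₀ x)) p μ) l (𝓝 0) := by
  have hlim := ENNReal.Tendsto.const_mul (a := ENNReal.LpAddConst p) (h₁.add h₂)
    (Or.inr (ENNReal.LpAddConst_lt_top p).ne)
  rw [add_zero, mul_zero] at hlim
  refine tendsto_of_tendsto_of_tendsto_of_le_of_le tendsto_const_nhds hlim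
    (fun _ => zero_le) fun i => ?_
  refine le_of_eq_of_le ?_ (eLpNorm_add_le' ((hu i).sub hu₀) ((hv i).sub hv₀) p)
  congr 1
  ext x
  simp only [Pi.add_apply, Pi.sub_apply]
  ring

theorem tendsto_eLpNorm_mul_sub {p q r : ℝ≥0∞} [ENNReal.HolderTriple p q r]
    (hu : ∀ i, AEStronglyMeasurable (u i) μ) (hv : ∀ i, AEStronglyMeasurable (v i) μ)
    (hu₀ : MemLp u₀ p μ) (hv₀ : MemLp v₀ q μ)
    (h₁ : Tendsto (fun i => eLpNorm (fun x => u i x - u₀ x) p μ) l (𝓝 0))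
    (h₂ : Tendsto (fun i => eLpNorm (fun x => v i x - v₀ x) q μ) l (𝓝 0)) :
    Tendsto (fun i => eLpNorm (fun x => u i x * v i x - u₀ x * v₀ x) r μ) l (𝓝 0) := by
  have hC : ENNReal.LpAddConst r ≠ ∞ := (ENNReal.LpAddConst_lt_top r).ne
  have hdu : ∀ i, AEStronglyMeasurable (fun x => u i x - u₀ x) μ := fun i => (hu i).sub hu₀.1
  have hdv : ∀ i, AEStronglyMeasurable (fun x => v i x - v₀ x) μ := fun i => (hv i).sub hv₀.1
  have hlim₁ : Tendsto (fun i => eLpNorm (fun x => (u i x - u₀ x) * v₀ x) r μ) l (𝓝 0) := by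
    have := ENNReal.Tendsto.mul_const h₁ (Or.inr hv₀.2.ne)
    rw [zero_mul] at this
    exact tendsto_of_tendsto_of_tendsto_of_le_of_le tendsto_const_nhds this
      (fun _ => zero_le) fun i => eLpNorm_mul_le (hdu i) hv₀.1
  have hlim₂ : Tendsto (fun i => eLpNorm (fun x => u₀ x * (v i x - v₀ x)) r μ) l (𝓝 0) := by
    have := ENNReal.Tendsto.const_mul h₂ (Or.inr hu₀.2.ne)
    rw [mul_zero] at this
    exact tendsto_of_tendsto_of_tendsto_of_le_of_le tendsto_const_nhds this
      (fun _ => zero_le) fun i => eLpNorm_mul_le hu₀.1 (hdv i)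
  have hlim₃ : Tendsto (fun i => eLpNorm (fun x => (u i x - u₀ x) * (v i x - v₀ x)) r μ) l
      (𝓝 0) := by
    have := ENNReal.Tendsto.mul h₁ (Or.inr ENNReal.zero_ne_top) h₂ (Or.inr ENNReal.zero_ne_top)
    rw [mul_zero] at this
    exact tendsto_of_tendsto_of_tendsto_of_le_of_le tendsto_const_nhds this
      (fun _ => zero_le) fun i => eLpNorm_mul_le (hdu i) (hdv i)
  -- Writing `δu = u - u₀` and `δv = v - v₀`, one has `u v - u₀ v₀ = δu δv + δu v₀ + u₀ δv`.
  have h := tendsto_eLpNorm_add_sub (p := r) (u₀ := 0) (v₀ := 0)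
    (fun i => ((hdu i).mul (hdv i)).add ((hdu i).mul hv₀.1)) (fun i => hu₀.1.mul (hdv i))
    aestronglyMeasurable_const aestronglyMeasurable_const
    (tendsto_eLpNorm_add_sub (p := r) (u₀ := 0) (v₀ := 0) (fun i => (hdu i).mul (hdv i))
      (fun i => (hdu i).mul hv₀.1) aestronglyMeasurable_const aestronglyMeasurable_const
      (by simpa using hlim₃) (by simpa using hlim₁)
      |>.congr fun i => by simp) (by simpa using hlim₂)
  refine h.congr fun i => ?_
  congr 1
  ext x
  simp only [Pi.add_apply, Pi.mul_apply, Pi.zero_apply]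
  ring

theorem memLp_of_tendsto_eLpNorm_sub [l.NeBot] {p : ℝ≥0∞} (hu : ∀ i, MemLp (u i) p μ)
    (hu₀ : AEStronglyMeasurable u₀ μ)
    (h₁ : Tendsto (fun i => eLpNorm (fun x => u i x - u₀ x) p μ) l (𝓝 0)) : MemLp u₀ p μ := by
  obtain ⟨i, hi⟩ := (h₁.eventually (gt_mem_nhds ENNReal.zero_lt_top)).exists
  have h : MemLp (fun x => u i x - u₀ x) p μ := ⟨(hu i).1.sub hu₀, hi⟩
  convert! (hu i).sub h using 1
  ext x
  simp

end Convergence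

theorem memLp_eval_fourier (P : Polynomial ℂ) (p : ℝ≥0∞) :
    MemLp (fun x : Torus => P.eval (fourier 1 x)) p haar := by
  have hc : Continuous fun x : Torus => P.eval (fourier 1 x) := P.continuous.comp (by fun_prop)
  obtain ⟨C, hC⟩ := isCompact_univ.exists_bound_of_continuousOn hc.continuousOn
  exact MemLp.of_bound hc.aestronglyMeasurable C (Eventually.of_forall fun x => hC x (mem_univ x))

/-- `g` is the boundary function, in the sense of `L^p` for some `0 < p < ∞`, of an analytic
function with value `c` at the origin. -/
def HardyVal (g : Torus → ℂ) (c : ℂ) : Prop :=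
  AEStronglyMeasurable g haar ∧ ∃ p : ℝ≥0∞, p ≠ 0 ∧ p ≠ ∞ ∧ ∃ P : ℕ → Polynomial ℂ,
    Tendsto (fun N => eLpNorm (fun x => (P N).eval (fourier 1 x) - g x) p haar) atTop (𝓝 0) ∧
    Tendsto (fun N => (P N).coeff 0) atTop (𝓝 c)

namespace HardyVal

variable {g h : Torus → ℂ} {a c : ℂ}

theorem congr (hg : HardyVal g c) (hgh : g =ᵐ[haar] h) : HardyVal h c := by
  obtain ⟨hm, p, hp, hp', P, hP, hP0⟩ := hg
  refine ⟨hm.congr hgh, p, hp, hp', P, ?_, hP0⟩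
  convert! hP using 2 with N
  exact eLpNorm_congr_ae (by filter_upwards [hgh] with x hx; rw [hx])

theorem const (c : ℂ) : HardyVal (fun _ => c) c :=
  ⟨aestronglyMeasurable_const, 1, one_ne_zero, ENNReal.one_ne_top, fun _ => Polynomial.C c,
    by simp, by simp⟩

theorem add (hg : HardyVal g c) (hh : HardyVal h a) : HardyVal (fun x => g x + h x) (c + a) := by
  obtain ⟨hm, p, hp, hp', P, hP, hP0⟩ := hg
  obtain ⟨hm', q, hq, hq', Q, hQ, hQ0⟩ := hh
  refine ⟨hm.add hm', min p q, by simp [hp, hq], by simp [hp'], fun N => P N + Q N, ?_, ?_⟩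
  · simp only [Polynomial.eval_add]
    have hsm := fun (P : Polynomial ℂ) => (memLp_eval_fourier P 1).1
    refine tendsto_eLpNorm_add_sub (fun N => hsm (P N)) (fun N => hsm (Q N)) hm hm' ?_ ?_
    · exact tendsto_of_tendsto_of_tendsto_of_le_of_le tendsto_const_nhds hP (fun _ => zero_le)
        fun N => eLpNorm_le_eLpNorm_of_exponent_le (min_le_left _ _) ((hsm _).sub hm)
    · exact tendsto_of_tendsto_of_tendsto_of_le_of_le tendsto_const_nhds hQ (fun _ => zero_le)
        fun N => eLpNorm_le_eLpNorm_of_exponent_le (min_le_right _ _) ((hsm _).sub hm')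
  · simpa using hP0.add hQ0

/-- Hölder with `1/r = 1/p + 1/q`: products of the approximating polynomials converge in `L^r`. This
is why exponents below `1` are admitted. -/
theorem mul (hg : HardyVal g c) (hh : HardyVal h a) : HardyVal (fun x => g x * h x) (c * a) := by
  obtain ⟨hm, p, hp, hp', P, hP, hP0⟩ := hg
  obtain ⟨hm', q, hq, hq', Q, hQ, hQ0⟩ := hh
  have : ENNReal.HolderTriple p q (p⁻¹ + q⁻¹)⁻¹ := ⟨by simp⟩
  refine ⟨hm.mul hm', (p⁻¹ + q⁻¹)⁻¹, by simp [hp, hq], by simp [hp'], fun N => P N * Q N, ?_, ?_⟩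
  · simp only [Polynomial.eval_mul]
    have hsm := fun (P : Polynomial ℂ) => (memLp_eval_fourier P 1).1
    exact tendsto_eLpNorm_mul_sub (fun N => hsm (P N)) (fun N => hsm (Q N))
      (memLp_of_tendsto_eLpNorm_sub (fun N => memLp_eval_fourier (P N) p) hm hP)
      (memLp_of_tendsto_eLpNorm_sub (fun N => memLp_eval_fourier (Q N) q) hm' hQ) hP hQ
  · simpa [Polynomial.mul_coeff_zero] using hP0.mul hQ0

theorem sum {ι : Type*} (s : Finset ι) {g : ι → Torus → ℂ} {c : ι → ℂ}
    (hg : ∀ i ∈ s, HardyVal (g i) (c i)) :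
    HardyVal (fun x => ∑ i ∈ s, g i x) (∑ i ∈ s, c i) := by
  classical
  induction s using Finset.induction_on with
  | empty => simpa using const 0
  | insert i s hi ih =>
    simp only [Finset.sum_insert hi]
    exact (hg i (by simp)).add (ih fun j hj => hg j (by simp [hj]))

theorem prod {ι : Type*} (s : Finset ι) {g : ι → Torus → ℂ} {c : ι → ℂ}
    (hg : ∀ i ∈ s, HardyVal (g i) (c i)) :
    HardyVal (fun x => ∏ i ∈ s, g i x) (∏ i ∈ s, c i) := by
  classical
  induction s using Finset.induction_on with
  | empty => simpa using const 1
  | insert i s hi ih =>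
    simp only [Finset.prod_insert hi]
    exact (hg i (by simp)).mul (ih fun j hj => hg j (by simp [hj]))

theorem det {n : Type*} [Fintype n] [DecidableEq n] {A : Torus → Matrix n n ℂ}
    {A₀ : Matrix n n ℂ} (hA : ∀ i j, HardyVal (fun x => A x i j) (A₀ i j)) :
    HardyVal (fun x => (A x).det) A₀.det := by
  simp only [Matrix.det_apply']
  exact sum _ fun σ _ => (const _).mul (prod _ fun i _ => hA _ _)

/-- Subharmonicity survives the limit. The exponent need not be the one in which the polynomials
converge, because on a probability space both norms dominate that of any smaller exponent. -/
theorem enorm_le (hg : HardyVal g c) {p : ℝ≥0∞} (hp : p ≠ 0) :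
    ‖c‖ₑ ≤ eLpNorm g p haar := by
  obtain ⟨hm, q, hq, hq', P, hP, hP0⟩ := hg
  have hsm := fun (P : Polynomial ℂ) => (memLp_eval_fourier P 1).1
  -- Taking the exponent at most `1` as well makes the `r`-th power of the `L^r` norm subadditive.
  have hr0 : min (min p q) 1 ≠ 0 := by simp [hp, hq]
  have hr1 : min (min p q) 1 ≠ ∞ := by simp
  have hrp : min (min p q) 1 ≤ p := (min_le_left _ _).trans (min_le_left _ _)
  have hrq : min (min p q) 1 ≤ q := (min_le_left _ _).trans (min_le_right _ _)
  have hrle : min (min p q) 1 ≤ 1 := min_le_right _ _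
  generalize min (min p q) 1 = r at *
  refine le_trans ?_ (eLpNorm_le_eLpNorm_of_exponent_le hrp hm)
  lift r to NNReal using hr1
  have hr : r ≠ 0 := by simpa using hr0
  have hr' : 0 < (r : ℝ) := by positivity
  have key : ∀ N, ‖(P N).coeff 0‖ₑ ^ (r : ℝ) ≤
      eLpNorm (fun x => (P N).eval (fourier 1 x) - g x) r haar ^ (r : ℝ) +
        eLpNorm g r haar ^ (r : ℝ) := fun N => by
    have h1 := enorm_coeff_zero_le_eLpNorm (P N) hr'
    rw [ENNReal.ofReal_coe_nnreal] at h1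
    refine (ENNReal.rpow_le_rpow h1 hr'.le).trans ?_
    rw [eLpNorm_nnreal_pow_eq_lintegral hr, eLpNorm_nnreal_pow_eq_lintegral hr,
      eLpNorm_nnreal_pow_eq_lintegral hr, ← lintegral_add_right']
    · refine lintegral_mono fun x => ?_
      refine le_trans ?_ (ENNReal.rpow_add_le_add_rpow _ _ (by positivity) (by exact_mod_cast hrle))
      gcongr
      simpa using enorm_add_le ((P N).eval (fourier 1 x) - g x) (g x)
    · exact hm.enorm.pow_const _
  have hlim : Tendsto (fun N => eLpNorm (fun x => (P N).eval (fourier 1 x) - g x) r haar ^ (r : ℝ))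
      atTop (𝓝 0) := by
    have : Tendsto (fun N => eLpNorm (fun x => (P N).eval (fourier 1 x) - g x) r haar)
        atTop (𝓝 0) :=
      tendsto_of_tendsto_of_tendsto_of_le_of_le tendsto_const_nhds hP (fun _ => zero_le)
        fun N => eLpNorm_le_eLpNorm_of_exponent_le hrq ((hsm _).sub hm)
    have h := ((ENNReal.continuous_rpow_const (y := (r : ℝ))).tendsto 0).comp this
    rwa [ENNReal.zero_rpow_of_pos hr'] at h
  have h2 := le_of_tendsto_of_tendsto'
    ((ENNReal.continuous_rpow_const (y := (r : ℝ))).tendsto _ |>.comp hP0.enorm)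
    (hlim.add_const (eLpNorm g r haar ^ (r : ℝ))) key
  rw [zero_add] at h2
  exact (ENNReal.rpow_le_rpow_iff hr').1 h2

theorem unique (hg : HardyVal g c) (hg' : HardyVal g a) : c = a := by
  have h := (hg.add ((const (-1)).mul hg')).enorm_le one_ne_zero
  have h0 : (fun x => g x + -1 * g x) = 0 := by ext x; simp
  rw [h0, eLpNorm_zero, nonpos_iff_eq_zero, enorm_eq_zero] at h
  linear_combination h

end HardyVal

theorem coeFn_sum_fourierLp {ι : Type*} (s : Finset ι) (c : ι → ℂ) (k : ι → ℤ) :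
    ⇑(∑ n ∈ s, c n • fourierLp (T := 2 * π) 2 (k n)) =ᵐ[haar]
      fun x => ∑ n ∈ s, c n * fourier (k n) x := by
  classical
  induction s using Finset.induction_on with
  | empty => exact Lp.coeFn_zero ℂ 2 haar
  | insert i s hi ih =>
    rw [Finset.sum_insert hi]
    filter_upwards [ih, Lp.coeFn_add (c i • fourierLp (T := 2 * π) 2 (k i))
      (∑ n ∈ s, c n • fourierLp (T := 2 * π) 2 (k n)),
      Lp.coeFn_smul (c i) (fourierLp (T := 2 * π) 2 (k i)),
      coeFn_fourierLp (T := 2 * π) 2 (k i)] with x h1 h2 h3 h4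
    rw [h2, Pi.add_apply, h1, h3, Pi.smul_apply, h4, Finset.sum_insert hi, smul_eq_mul]

theorem fourier_natCast (n : ℕ) (x : Torus) : fourier (n : ℤ) x = fourier 1 x ^ n := by
  induction n with
  | zero => simp
  | succ n ih => rw [pow_succ, ← ih, ← fourier_add]; push_cast; rfl

/-- An `L²` function with vanishing negative Fourier coefficients is the boundary function of
an analytic function. -/
theorem HardyVal.of_fourierCoeff (u : Lp ℂ 2 haar) (hu : ∀ n < 0, fourierCoeff u n = 0) :
    HardyVal u (fourierCoeff u 0) := by
  have h0 : HasSum (fun n : ℤ => fourierCoeff u n • fourierLp (T := 2 * π) 2 n) u :=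
    hasSum_fourier_series_L2 (T := 2 * π) u
  have hsupp : ∀ n ∉ range ((↑) : ℕ → ℤ),
      fourierCoeff u n • fourierLp (T := 2 * π) 2 n = 0 := fun n hn => by
    have hn0 : n < 0 := by
      by_contra h
      exact hn ⟨n.toNat, Int.toNat_of_nonneg (not_lt.1 h)⟩
    rw [hu n hn0, zero_smul]
  have h1 : HasSum (fun n : ℕ => fourierCoeff u n • fourierLp (T := 2 * π) 2 (n : ℤ)) u :=
    (Function.Injective.hasSum_iff (g := ((↑) : ℕ → ℤ)) Nat.cast_injective hsupp).2 h0
  refine ⟨(Lp.memLp u).1, 2, two_ne_zero, ENNReal.ofNat_ne_top,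
    -- Partial Fourier sums; the shift `N + 1` keeps the constant term present for every `N`.
    fun N => ∑ n ∈ Finset.range (N + 1), Polynomial.C (fourierCoeff u n) * Polynomial.X ^ n, ?_, ?_⟩
  · have h2 := (tendsto_iff_norm_sub_tendsto_zero.1 h1.tendsto_sum_nat)
    have h3 := ENNReal.tendsto_ofReal (h2.comp (tendsto_add_atTop_nat 1))
    rw [ENNReal.ofReal_zero] at h3
    refine h3.congr fun N => ?_
    simp only [Function.comp_apply]
    rw [ofReal_norm, Lp.enorm_def]
    apply eLpNorm_congr_ae
    filter_upwards [Lp.coeFn_sub (∑ n ∈ Finset.range (N + 1), fourierCoeff u n •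
      fourierLp (T := 2 * π) 2 (n : ℤ)) u, coeFn_sum_fourierLp (Finset.range (N + 1))
      (fun n => fourierCoeff u n) (fun n => (n : ℤ))] with x hx hx'
    rw [hx, Pi.sub_apply, hx']
    simp only [Polynomial.eval_finsetSum, Polynomial.eval_mul, Polynomial.eval_C,
      Polynomial.eval_pow, Polynomial.eval_X, fourier_natCast]
  · simp [Polynomial.coeff_X_pow]

end

/-! ### Determinant inequality, uniqueness of Fourier coefficients, and the shift on `L²(ℂ^d)`. -/

section

open scoped ComplexOrder in
/-- The Hadamard inequality in the form given by the inequality of arithmetic and geometric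
means for the eigenvalues of `Aᴴ A`. -/
theorem norm_det_rpow_le {d : ℕ} (hd : 0 < d) (A : Matrix (Fin d) (Fin d) ℂ) :
    ‖A.det‖ ^ (2 / d : ℝ) ≤ (d : ℝ)⁻¹ * ∑ i, ∑ j, ‖A i j‖ ^ 2 := by
  have hd' : (d : ℝ) ≠ 0 := by positivity
  have hP := Matrix.posSemidef_conjTranspose_mul_self A
  have h := Real.geom_mean_le_arith_mean_weighted Finset.univ (fun _ : Fin d => (d : ℝ)⁻¹)
    hP.isHermitian.eigenvalues (fun _ _ => by positivity) (by simp [hd'])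
    (fun i _ => hP.eigenvalues_nonneg i)
  rw [Real.finsetProd_rpow _ _ fun i _ => hP.eigenvalues_nonneg i, ← Finset.mul_sum] at h
  have hdet : ∏ i, hP.isHermitian.eigenvalues i = ‖A.det‖ ^ (2 : ℕ) := by
    have := hP.isHermitian.det_eq_prod_eigenvalues
    rw [Matrix.det_mul, Matrix.det_conjTranspose, ← starRingEnd_apply, Complex.conj_mul'] at this
    apply Complex.ofReal_injective
    push_cast
    exact this.symm
  have htr : ∑ i, hP.isHermitian.eigenvalues i = ∑ i, ∑ j, ‖A i j‖ ^ 2 := by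
    have := hP.isHermitian.trace_eq_sum_eigenvalues
    rw [Finset.sum_comm]
    simp only [Matrix.trace, Matrix.diag_apply, Matrix.mul_apply, Matrix.conjTranspose_apply,
      ← starRingEnd_apply, Complex.conj_mul'] at this
    apply Complex.ofReal_injective
    push_cast
    exact this.symm
  rw [hdet, htr, ← Real.rpow_natCast, ← Real.rpow_mul (norm_nonneg _)] at h
  simpa [div_eq_mul_inv] using h

/-- The functional `φ ↦ ∫ φ g` is continuous for the uniform norm and vanishes on the characters,
whose span is dense. -/
theorem integral_mul_eq_zero_of_fourierCoeff {g : Torus → ℂ} (hg : Integrable g haar)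
    (h : ∀ n, fourierCoeff g n = 0) (φ : C(Torus, ℂ)) : ∫ x, φ x * g x ∂haar = 0 := by
  have hint : ∀ φ : C(Torus, ℂ), Integrable (fun x => φ x * g x) haar := fun φ =>
    hg.bdd_mul φ.continuous.aestronglyMeasurable (Eventually.of_forall φ.norm_coe_le_norm)
  let L : C(Torus, ℂ) →ₗ[ℂ] ℂ :=
    { toFun := fun φ => ∫ x, φ x * g x ∂haar
      map_add' := fun φ ψ => by
        simp only [ContinuousMap.add_apply, add_mul]
        exact integral_add (hint φ) (hint ψ)
      map_smul' := fun c φ => by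
        simp only [ContinuousMap.smul_apply, smul_eq_mul, mul_assoc, RingHom.id_apply]
        exact integral_const_mul _ _ }
  let L' := L.mkContinuous (∫ x, ‖g x‖ ∂haar) fun φ => by
    refine (norm_integral_le_integral_norm _).trans ?_
    rw [mul_comm _ ‖φ‖, ← integral_const_mul]
    refine integral_mono (hint φ).norm (hg.norm.const_mul _) fun x => ?_
    rw [norm_mul]
    gcongr
    exact φ.norm_coe_le_norm x
  have hle : (Submodule.span ℂ (range <| @fourier (2 * π))).topologicalClosure ≤
      L'.toLinearMap.ker := by
    refine Submodule.topologicalClosure_minimal _ (Submodule.span_le.2 ?_) L'.isClosed_ker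
    rintro _ ⟨n, rfl⟩
    have := h (-n)
    simpa [fourierCoeff, L', L] using this
  rw [span_fourier_closure_eq_top] at hle
  exact hle (Submodule.mem_top (x := φ))

/-- An integrable function all of whose Fourier coefficients vanish is zero. -/
theorem ae_eq_zero_of_fourierCoeff {g : Torus → ℂ} (hg : Integrable g haar)
    (h : ∀ n, fourierCoeff g n = 0) : g =ᵐ[haar] 0 := by
  -- Indicators of closed sets are bounded pointwise limits of continuous functions, so dominated
  -- convergence applies.
  refine ae_eq_zero_of_forall_setIntegral_isClosed_eq_zero hg fun s hs => ?_
  have hδ : ∀ n : ℕ, (0 : ℝ) < 1 / ((n : ℝ) + 1) := fun n => by positivity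
  have hlim : Tendsto (fun n : ℕ => ∫ x, ((thickenedIndicator (hδ n) s x : ℝ) : ℂ) * g x ∂haar)
      atTop (𝓝 (∫ x, s.indicator g x ∂haar)) := by
    refine tendsto_integral_of_dominated_convergence (fun x => ‖g x‖) (fun n => ?_) hg.norm
      (fun n => ?_) ?_
    · refine AEStronglyMeasurable.mul (Continuous.aestronglyMeasurable ?_) hg.1
      exact Complex.continuous_ofReal.comp
        (NNReal.continuous_coe.comp (thickenedIndicator (hδ n) s).continuous)
    · refine Eventually.of_forall fun x => ?_
      rw [norm_mul, Complex.norm_real, NNReal.norm_eq]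
      refine mul_le_of_le_one_left (norm_nonneg _) ?_
      exact_mod_cast thickenedIndicator_le_one (hδ n) s x
    · refine Eventually.of_forall fun x => ?_
      have h1 := tendsto_pi_nhds.1 (thickenedIndicator_tendsto_indicator_closure hδ
        tendsto_one_div_add_atTop_nhds_zero_nat s) x
      rw [hs.closure_eq] at h1
      have h2 := ((Complex.continuous_ofReal.comp NNReal.continuous_coe).tendsto _).comp h1
      convert! h2.mul_const (g x) using 2
      by_cases hx : x ∈ s <;> simp [hx]
  rw [← integral_indicator hs.measurableSet]
  refine tendsto_nhds_unique hlim (tendsto_const_nhds.congr fun n => ?_)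
  exact (integral_mul_eq_zero_of_fourierCoeff hg h ⟨fun x => (thickenedIndicator (hδ n) s x : ℝ),
    Complex.continuous_ofReal.comp
      (NNReal.continuous_coe.comp (thickenedIndicator (hδ n) s).continuous)⟩).symm

/-- Multiplication by `ζ ^ n` on `L²` of the circle. -/
def mulFourier (n : ℤ) : Lp ℂ 2 haar →L[ℂ] Lp ℂ 2 haar :=
  (ContinuousLinearMap.mul ℂ ℂ).holderL haar ∞ 2 2 (fourierLp (T := 2 * π) ∞ n)

theorem coeFn_mulFourier (n : ℤ) (u : Lp ℂ 2 haar) :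
    mulFourier n u =ᵐ[haar] fun x => fourier n x * u x := by
  filter_upwards [(ContinuousLinearMap.mul ℂ ℂ).coeFn_holder (r := 2) (fourierLp (T := 2 * π) ∞ n) u,
    coeFn_fourierLp (T := 2 * π) ∞ n] with x h1 h2
  rw [← h2]
  exact h1

theorem fourierCoeff_mulFourier (n k : ℤ) (u : Lp ℂ 2 haar) :
    fourierCoeff (mulFourier n u) k = fourierCoeff u (k - n) := by
  refine integral_congr_ae ?_
  filter_upwards [coeFn_mulFourier n u] with x hx
  rw [hx, neg_sub, sub_eq_add_neg, fourier_add, smul_eq_mul, smul_eq_mul]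
  ring

theorem mulFourier_add (m n : ℤ) (u : Lp ℂ 2 haar) :
    mulFourier (m + n) u = mulFourier m (mulFourier n u) := by
  apply Lp.ext
  filter_upwards [coeFn_mulFourier (m + n) u, coeFn_mulFourier m (mulFourier n u),
    coeFn_mulFourier n u] with x h1 h2 h3
  rw [h1, h2, h3, fourier_add, mul_assoc]

theorem mulFourier_zero (u : Lp ℂ 2 haar) : mulFourier 0 u = u := by
  apply Lp.ext
  filter_upwards [coeFn_mulFourier 0 u] with x h1
  rw [h1, fourier_zero, one_mul]

variable {d : ℕ}

/-- The space of square integrable `ℂ^d`-valued functions on the circle. -/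
abbrev VecL2 (d : ℕ) : Type := PiLp 2 fun _ : Fin d => Lp ℂ 2 haar

/-- Multiplication by `ζ ^ n` on vector-valued `L²` of the circle. -/
def shift (n : ℤ) : VecL2 d →L[ℂ] VecL2 d :=
  ((PiLp.continuousLinearEquiv 2 ℂ fun _ : Fin d => Lp ℂ 2 haar).symm :
      (Fin d → Lp ℂ 2 haar) →L[ℂ] VecL2 d) ∘L
    ContinuousLinearMap.pi fun i => mulFourier n ∘L PiLp.proj 2 (fun _ : Fin d => Lp ℂ 2 haar) i

@[simp]
theorem shift_apply (n : ℤ) (u : VecL2 d) (i : Fin d) : shift n u i = mulFourier n (u i) := rfl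

theorem shift_add (m n : ℤ) (u : VecL2 d) : shift (m + n) u = shift m (shift n u) := by
  ext1 i
  simp [mulFourier_add]

theorem shift_zero (u : VecL2 d) : shift 0 u = u := by
  ext1 i
  simp [mulFourier_zero]

/-- The pointwise inner product of two vector-valued functions on the circle. -/
def pointwiseInner (w u : VecL2 d) (x : Torus) : ℂ :=
  ∑ l, starRingEnd ℂ (w l x) * u l x

theorem integrable_pointwiseInner (w u : VecL2 d) : Integrable (pointwiseInner w u) haar := by
  refine integrable_finsetSum _ fun l _ => ?_
  have := L2.integrable_inner (𝕜 := ℂ) (w l) (u l)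
  simpa only [RCLike.inner_apply'] using this

/-- Turns orthogonality to shifts into pointwise information on the circle. -/
theorem inner_shift (w u : VecL2 d) (n : ℤ) :
    inner ℂ w (shift n u) = fourierCoeff (pointwiseInner w u) (-n) := by
  rw [PiLp.inner_apply, fourierCoeff]
  simp only [L2.inner_def, pointwiseInner, neg_neg, shift_apply, smul_eq_mul, Finset.mul_sum]
  rw [integral_finsetSum]
  · refine Finset.sum_congr rfl fun l _ => integral_congr_ae ?_
    filter_upwards [coeFn_mulFourier n (u l)] with x hx
    rw [hx, RCLike.inner_apply']
    ring
  · intro l _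
    have := L2.integrable_inner (𝕜 := ℂ) (w l) (mulFourier n (u l))
    refine this.congr ?_
    filter_upwards [coeFn_mulFourier n (u l)] with x hx
    rw [hx, RCLike.inner_apply']
    ring

theorem fourierCoeff_pointwiseInner_neg (w u : VecL2 d) (n : ℤ) :
    fourierCoeff (pointwiseInner w u) (-n) =
      starRingEnd ℂ (fourierCoeff (pointwiseInner u w) n) := by
  rw [fourierCoeff, fourierCoeff, ← integral_conj]
  congr 1
  ext x
  simp only [pointwiseInner, smul_eq_mul, map_mul, map_sum, Complex.conj_conj, neg_neg,
    ← fourier_neg]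
  congr 1
  exact Finset.sum_congr rfl fun l _ => mul_comm _ _

end

/-! ### Analytic functions in `L²(ℂ^d)` and wandering families of invariant subspaces. -/

section

variable {d : ℕ}

/-- The `n`-th Fourier coefficient as a continuous linear functional on `L²`. -/
def coeffL (n : ℤ) : Lp ℂ 2 haar →L[ℂ] ℂ := innerSL ℂ (fourierBasis (T := 2 * π) n)

theorem coeffL_apply (n : ℤ) (u : Lp ℂ 2 haar) : coeffL n u = fourierCoeff u n := by
  rw [← fourierBasis_repr, fourierBasis.repr_apply_apply]
  rfl

theorem integral_norm_sq (u : Lp ℂ 2 haar) : ∫ x, ‖u x‖ ^ 2 ∂haar = ‖u‖ ^ 2 := by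
  have h := L2.inner_def (𝕜 := ℂ) u u
  simp only [inner_self_eq_norm_sq_to_K] at h
  have h2 : ((‖u‖ ^ 2 : ℝ) : ℂ) = ((∫ x, ‖u x‖ ^ 2 ∂haar : ℝ) : ℂ) := by
    rw [← integral_complex_ofReal]
    push_cast
    exact h
  exact_mod_cast h2.symm

theorem hasSum_norm_fourierCoeff (u : Lp ℂ 2 haar) :
    HasSum (fun n => ‖fourierCoeff u n‖ ^ 2) (‖u‖ ^ 2) := by
  rw [← integral_norm_sq]
  exact hasSum_sq_fourierCoeff u

/-- The value at the origin of an analytic vector-valued function, as a function of its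
boundary values. -/
def evalZero : VecL2 d →L[ℂ] (Fin d → ℂ) :=
  ContinuousLinearMap.pi fun i => coeffL 0 ∘L PiLp.proj 2 (fun _ : Fin d => Lp ℂ 2 haar) i

theorem evalZero_apply (u : VecL2 d) (i : Fin d) : evalZero u i = fourierCoeff (u i) 0 :=
  coeffL_apply 0 (u i)

/-- All negative Fourier coefficients vanish. -/
def IsAnalytic (u : VecL2 d) : Prop := ∀ i, ∀ n < 0, fourierCoeff (u i) n = 0

/-- The constant functions in `L²`. -/
def constVec (c : Fin d → ℂ) : VecL2 d := WithLp.toLp 2 fun i => c i • fourierLp (T := 2 * π) 2 0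

theorem IsAnalytic.hardyVal {u : VecL2 d} (hu : IsAnalytic u) (i : Fin d) :
    HardyVal (u i) (evalZero u i) := by
  rw [evalZero_apply]
  exact HardyVal.of_fourierCoeff (u i) (hu i)

theorem evalZero_shift_one {u : VecL2 d} (hu : IsAnalytic u) : evalZero (shift 1 u) = 0 := by
  ext i
  rw [evalZero_apply, shift_apply, fourierCoeff_mulFourier]
  exact hu i _ (by norm_num)

theorem isClosed_setOf_isAnalytic : IsClosed {u : VecL2 d | IsAnalytic u} := by
  simp only [IsAnalytic, ofPred_forall]
  refine isClosed_iInter fun i => isClosed_iInter fun n => isClosed_iInter fun _ => ?_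
  simp only [← coeffL_apply]
  exact isClosed_eq ((coeffL n ∘L PiLp.proj 2 (fun _ : Fin d => Lp ℂ 2 haar) i).continuous)
    continuous_const

section Invariant

variable {D : Submodule ℂ (VecL2 d)}

theorem isAnalytic_of_mem_closure (hD : ∀ u ∈ D, IsAnalytic u) {u : VecL2 d}
    (hu : u ∈ D.topologicalClosure) : IsAnalytic u :=
  closure_minimal hD isClosed_setOf_isAnalytic hu

theorem shift_mem_closure_map {u : VecL2 d} (hu : u ∈ D.topologicalClosure) :
    shift 1 u ∈ (D.map (shift 1).toLinearMap).topologicalClosure :=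
  image_closure_subset_closure_image (shift 1).continuous (mem_image_of_mem _ hu)

theorem shift_mem_closure (hS : ∀ u ∈ D, shift 1 u ∈ D) {u : VecL2 d}
    (hu : u ∈ D.topologicalClosure) (n : ℕ) : shift n u ∈ D.topologicalClosure := by
  induction n with
  | zero => simpa [shift_zero] using hu
  | succ n ih =>
    rw [Nat.cast_succ, add_comm, shift_add]
    refine Submodule.topologicalClosure_mono ?_ (shift_mem_closure_map ih)
    rintro _ ⟨v, hv, rfl⟩
    exact hS v hv

/-- The wandering subspace of a shift-invariant space of analytic functions with surjective
evaluation at the origin contains an orthonormal family of full size. -/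
theorem exists_wandering (hD : ∀ u ∈ D, IsAnalytic u) (hS : ∀ u ∈ D, shift 1 u ∈ D)
    (hsurj : ∀ c, ∃ u ∈ D, evalZero u = c) :
    ∃ w : Fin d → VecL2 d, Orthonormal ℂ w ∧ (∀ j, w j ∈ D.topologicalClosure) ∧
      ∀ j, ∀ u ∈ D.topologicalClosure, ∀ n : ℕ, inner ℂ (w j) (shift (n + 1 : ℕ) u) = 0 := by
  set M := D.topologicalClosure with hM
  set N := (D.map (shift 1).toLinearMap).topologicalClosure with hN
  have hNM : N ≤ M := by
    refine Submodule.topologicalClosure_mono ?_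
    rintro _ ⟨v, hv, rfl⟩
    exact hS v hv
  have : CompleteSpace N := (Submodule.isClosed_topologicalClosure _).completeSpace_coe
  have hN0 : ∀ u ∈ N, evalZero u = 0 := by
    intro u hu
    have : N ≤ (evalZero (d := d)).toLinearMap.ker := by
      refine Submodule.topologicalClosure_minimal _ ?_ (evalZero (d := d)).isClosed_ker
      rintro _ ⟨v, hv, rfl⟩
      exact evalZero_shift_one (hD v hv)
    exact this hu
  choose u hu hu0 using fun j : Fin d => hsurj (Pi.single j 1)
  -- Functions in `N` vanish at the origin, so removing the projection keeps the values `e_j` there;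
  -- independence of these values gives independence of the functions.
  set w' : Fin d → VecL2 d := fun j => u j - N.starProjection (u j) with hw'
  have hw'0 : ∀ j, evalZero (w' j) = Pi.single j 1 := fun j => by
    rw [hw', map_sub, hN0 _ (N.starProjection_apply_mem _), sub_zero, hu0]
  have hw'M : ∀ j, w' j ∈ M ⊓ Nᗮ := fun j =>
    ⟨M.sub_mem (D.le_topologicalClosure (hu j)) (hNM (N.starProjection_apply_mem _)),
      N.sub_starProjection_mem_orthogonal _⟩
  have hli : LinearIndependent ℂ w' := by
    refine LinearIndependent.of_comp (evalZero (d := d)).toLinearMap ?_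
    have : (evalZero (d := d)).toLinearMap ∘ w' = fun j => Pi.single j 1 := funext hw'0
    rw [this]
    convert! (Pi.basisFun ℂ (Fin d)).linearIndependent using 1
    ext j
    simp
  have hmem : ∀ j, InnerProductSpace.gramSchmidtNormed ℂ w' j ∈ M ⊓ Nᗮ := fun j => by
    have h1 : InnerProductSpace.gramSchmidtNormed ℂ w' j ∈
        Submodule.span ℂ (range (InnerProductSpace.gramSchmidtNormed ℂ w')) :=
      Submodule.subset_span (mem_range_self j)
    rw [InnerProductSpace.span_gramSchmidtNormed_range, InnerProductSpace.span_gramSchmidt] at h1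
    exact Submodule.span_le.2 (by rintro _ ⟨i, rfl⟩; exact hw'M i) h1
  refine ⟨_, InnerProductSpace.gramSchmidtNormed_orthonormal hli, fun j => (hmem j).1,
    fun j u hu n => ?_⟩
  rw [Nat.cast_succ, add_comm, shift_add]
  exact Submodule.inner_left_of_mem_orthogonal
    (shift_mem_closure_map (shift_mem_closure hS hu n)) (hmem j).2

variable {w : Fin d → VecL2 d}

/-- Wandering kills the negative Fourier coefficients of `⟨w_i, w_j⟩`, and exchanging `i` and `j`
with conjugation kills the positive ones. The remaining constant is given by orthonormality. -/
theorem ae_conjTranspose_mul_self (hw : Orthonormal ℂ w)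
    (hwan : ∀ i j, ∀ n : ℕ, inner ℂ (w i) (shift (n + 1 : ℕ) (w j)) = 0) :
    ∀ᵐ x ∂haar, ∀ i j, pointwiseInner (w i) (w j) x = if i = j then 1 else 0 := by
  refine ae_all_iff.2 fun i => ae_all_iff.2 fun j => ?_
  have hcoeff : ∀ i j, ∀ n : ℤ, n ≠ 0 → fourierCoeff (pointwiseInner (w i) (w j)) n = 0 := by
    have hneg : ∀ i j, ∀ n : ℕ, fourierCoeff (pointwiseInner (w i) (w j)) (-(n + 1 : ℕ)) = 0 :=
      fun i j n => by rw [← inner_shift]; exact hwan i j n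
    intro i j n hn
    rcases lt_or_gt_of_ne hn with h | h
    · obtain ⟨m, rfl⟩ := Int.eq_negSucc_of_lt_zero h
      exact hneg i j m
    · have h2 := fourierCoeff_pointwiseInner_neg (w i) (w j) (-n)
      obtain ⟨m, rfl⟩ : ∃ m : ℕ, n = (m + 1 : ℕ) := ⟨n.toNat - 1, by omega⟩
      rw [neg_neg] at h2
      rw [h2, hneg, map_zero]
  have hcoeff0 : fourierCoeff (pointwiseInner (w i) (w j)) 0 = if i = j then 1 else 0 := by
    have := inner_shift (w i) (w j) 0
    rw [shift_zero, neg_zero, orthonormal_iff_ite.1 hw] at this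
    exact this.symm
  have hint : Integrable (fun x => pointwiseInner (w i) (w j) x + -(if i = j then 1 else 0)) haar :=
    (integrable_pointwiseInner _ _).add (integrable_const _)
  have hconst : ∀ (c : ℂ) (n : ℤ), fourierCoeff (fun _ : Torus => c) n = if n = 0 then c else 0 := by
    intro c n
    have h1 := fourierCoeff.const_mul (T := 2 * π) (fourier 0) c n
    simp only [fourier_zero, mul_one] at h1
    rw [h1, fourierCoeff_fourier]
    simp [Pi.single_apply]
  have h0 := ae_eq_zero_of_fourierCoeff hint fun n => by
    rw [show (fun x => pointwiseInner (w i) (w j) x + -(if i = j then 1 else 0)) =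
      pointwiseInner (w i) (w j) + fun _ : Torus => -(if i = j then (1 : ℂ) else 0) from rfl,
      fourierCoeff.add (integrable_pointwiseInner _ _) (integrable_const _), Pi.add_apply, hconst]
    by_cases hn : n = 0
    · subst hn
      rw [hcoeff0]
      simp
    · simp [hcoeff i j n hn, hn]
  filter_upwards [h0] with x hx
  simp only [Pi.zero_apply] at hx
  linear_combination hx

/-- The coordinates of a function in an invariant space with respect to a wandering family are
boundary values of analytic functions. -/
theorem hardyVal_pointwiseInner {w u : VecL2 d} (hw : ∀ᵐ x ∂haar, pointwiseInner w w x = 1)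
    (hwan : ∀ n : ℕ, inner ℂ w (shift (n + 1 : ℕ) u) = 0) :
    ∃ c, HardyVal (pointwiseInner w u) c := by
  have hm : MemLp (pointwiseInner w u) 2 haar := by
    -- The entries of `w` are bounded by `1`, so the product is in `L²` and not merely in `L¹`.
    refine memLp_finsetSum _ fun l _ => ?_
    refine (Lp.memLp (u l)).mono ((continuous_star.comp_aestronglyMeasurable
      (Lp.memLp (w l)).1).mul (Lp.memLp (u l)).1) ?_
    filter_upwards [hw] with x hx
    have h1 : ∑ l, ‖w l x‖ ^ 2 = 1 := by
      simp only [pointwiseInner, Complex.conj_mul'] at hx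
      exact_mod_cast hx
    have h2 : ‖w l x‖ ^ 2 ≤ 1 := h1 ▸
      Finset.single_le_sum (f := fun l => ‖w l x‖ ^ 2) (fun _ _ => by positivity)
        (Finset.mem_univ l)
    rw [norm_mul, RCLike.norm_conj]
    exact mul_le_of_le_one_left (norm_nonneg _) ((sq_le_one_iff₀ (norm_nonneg _)).1 h2)
  refine ⟨_, (HardyVal.of_fourierCoeff hm.toLp fun n hn => ?_).congr hm.coeFn_toLp⟩
  rw [fourierCoeff_congr_ae hm.coeFn_toLp]
  obtain ⟨m, rfl⟩ := Int.eq_negSucc_of_lt_zero hn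
  have := inner_shift w u (m + 1 : ℕ)
  rw [hwan m] at this
  exact this.symm

end Invariant

end

/-! ### The determinant estimate and the density theorem for invariant subspaces. -/

section

variable {d : ℕ}

theorem integral_sum_norm_sq (v : Fin d → VecL2 d) :
    ∫ x, ∑ i, ∑ j, ‖v j i x‖ ^ 2 ∂haar = ∑ j, ‖v j‖ ^ 2 := by
  have hint : ∀ i j, Integrable (fun x => ‖v j i x‖ ^ 2) haar := fun i j => by
    simpa using (Lp.memLp (v j i)).integrable_norm_pow (p := 2) (by norm_num)
  rw [integral_finsetSum _ fun i _ => integrable_finsetSum _ fun j _ => hint i j]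
  simp_rw [integral_finsetSum _ fun j _ => hint _ j, integral_norm_sq]
  rw [Finset.sum_comm]
  exact Finset.sum_congr rfl fun j _ => (PiLp.norm_sq_eq_of_L2 _ _).symm

theorem eLpNorm_det_le (hd : 0 < d) (v : Fin d → VecL2 d) :
    eLpNorm (fun x => (Matrix.of fun i j => v j i x).det) (ENNReal.ofReal (2 / d)) haar ^
      (2 / d : ℝ) ≤ ENNReal.ofReal ((d : ℝ)⁻¹ * ∑ j, ‖v j‖ ^ 2) := by
  have hd' : 0 < (2 / d : ℝ) := by positivity
  have hint : Integrable (fun x => (d : ℝ)⁻¹ * ∑ i, ∑ j, ‖v j i x‖ ^ 2) haar :=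
    (integrable_finsetSum _ fun i _ => integrable_finsetSum _ fun j _ => by
      simpa using (Lp.memLp (v j i)).integrable_norm_pow (p := 2) (by norm_num)).const_mul _
  have h := eLpNorm_nnreal_pow_eq_lintegral (μ := haar) (p := (2 / d : ℝ).toNNReal)
    (f := fun x => (Matrix.of fun i j => v j i x).det) (by simpa using hd)
  rw [Real.coe_toNNReal _ hd'.le] at h
  rw [ENNReal.ofReal, h, ← integral_sum_norm_sq, ← integral_const_mul,
    ofReal_integral_eq_lintegral_ofReal hint (Eventually.of_forall fun x => by positivity)]
  refine lintegral_mono fun x => ?_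
  rw [← ofReal_norm, ENNReal.ofReal_rpow_of_nonneg (norm_nonneg _) hd'.le]
  exact ENNReal.ofReal_le_ofReal (norm_det_rpow_le hd _)

variable {D : Submodule ℂ (VecL2 d)} {A : Fin d → Fin d → Lp ℂ 2 haar} {w u v : Fin d → VecL2 d}

/-- The matrix of the values at the origin. -/
def evalMatrix (u : Fin d → VecL2 d) : Matrix (Fin d) (Fin d) ℂ :=
  Matrix.of fun i j => evalZero (u j) i

/-- The relation `V = A U` is known only on the circle; uniqueness of the value at the origin
carries it inside the disc. -/
theorem evalMatrix_eq_mul (hA : ∀ i j, ∀ n < 0, fourierCoeff (A i j) n = 0)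
    (hu : ∀ j, IsAnalytic (u j)) (hv : ∀ j, IsAnalytic (v j))
    (hvu : ∀ j i, v j i =ᵐ[haar] fun x => ∑ l, A i l x * u j l x) :
    evalMatrix v = (Matrix.of fun i j => fourierCoeff (A i j) 0) * evalMatrix u := by
  ext i j
  rw [Matrix.mul_apply]
  refine ((hv j).hardyVal i).unique (HardyVal.congr (HardyVal.sum _ fun l _ =>
    (HardyVal.of_fourierCoeff (A i l) (hA i l)).mul ((hu j).hardyVal l)) (hvu j i).symm)

/-- With `H = W* U`, one has `V = A W H`. The unimodular factor `det W` disappears from the norm on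
the circle but remains at the origin, which leaves `|det W(0)|` in the bound. -/
theorem norm_det_evalMatrix_le (hd : 0 < d)
    (hA : ∀ i j, ∀ n < 0, fourierCoeff (A i j) n = 0)
    (hw : Orthonormal ℂ w) (hwa : ∀ j, IsAnalytic (w j))
    (hww : ∀ i j, ∀ n : ℕ, inner ℂ (w i) (shift (n + 1 : ℕ) (w j)) = 0)
    (hu : ∀ j, IsAnalytic (u j)) (hv : ∀ j, IsAnalytic (v j))
    (hwu : ∀ i j, ∀ n : ℕ, inner ℂ (w i) (shift (n + 1 : ℕ) (u j)) = 0)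
    (hvu : ∀ j i, v j i =ᵐ[haar] fun x => ∑ l, A i l x * u j l x) :
    ‖(evalMatrix v).det‖ ^ (2 / d : ℝ) ≤
      ‖(evalMatrix w).det‖ ^ (2 / d : ℝ) * ((d : ℝ)⁻¹ * ∑ j, ‖v j‖ ^ 2) := by
  have hd' : 0 < (2 / d : ℝ) := by positivity
  have hunit := ae_conjTranspose_mul_self hw hww
  choose H₀ hH₀ using fun i j => hardyVal_pointwiseInner
    (by filter_upwards [hunit] with x hx; simpa using hx i i) (hwu i j)
  set Wx : Torus → Matrix (Fin d) (Fin d) ℂ := fun x => Matrix.of fun i j => w j i x with hWx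
  set Ux : Torus → Matrix (Fin d) (Fin d) ℂ := fun x => Matrix.of fun i j => u j i x with hUx
  set Vx : Torus → Matrix (Fin d) (Fin d) ℂ := fun x => Matrix.of fun i j => v j i x with hVx
  set Ax : Torus → Matrix (Fin d) (Fin d) ℂ := fun x => Matrix.of fun i j => A i j x with hAx
  have hHx : ∀ x, (Matrix.of fun i j => pointwiseInner (w i) (u j) x) = (Wx x).conjTranspose * Ux x :=
    fun x => by
      ext i j
      simp [Matrix.mul_apply, pointwiseInner, hWx, hUx]
  have hWW : ∀ᵐ x ∂haar, (Wx x).conjTranspose * Wx x = 1 := by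
    filter_upwards [hunit] with x hx
    ext i j
    rw [Matrix.one_apply, ← hx i j]
    simp [Matrix.mul_apply, pointwiseInner, hWx]
  have hVA : ∀ᵐ x ∂haar, Vx x = Ax x * Ux x := by
    filter_upwards [ae_all_iff.2 fun j => ae_all_iff.2 fun i => hvu j i] with x hx
    ext i j
    simpa [Matrix.mul_apply, hAx, hUx, hVx] using hx j i
  -- Because `W` is square, `W* W = 1` also gives `W W* = 1`, hence `U = W H`.
  have hU0 : evalMatrix u = evalMatrix w * Matrix.of H₀ := by
    ext i j
    rw [Matrix.mul_apply]
    refine ((hu j).hardyVal i).unique (HardyVal.congr (HardyVal.sum _ fun l _ =>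
      ((hwa l).hardyVal i).mul (hH₀ l j)) ?_)
    filter_upwards [hWW] with x hx
    have h1 : Wx x * ((Wx x).conjTranspose * Ux x) = Ux x := by
      rw [← mul_assoc, mul_eq_one_comm.1 hx, one_mul]
    rw [← hHx] at h1
    simpa [Matrix.mul_apply, hWx, hUx] using congr_fun₂ h1 i j
  have hk : HardyVal (fun x => (Ax x).det *
      (Matrix.of fun i j => pointwiseInner (w i) (u j) x).det)
      ((Matrix.of fun i j => fourierCoeff (A i j) 0).det * (Matrix.of H₀).det) :=
    (HardyVal.det fun i j => HardyVal.of_fourierCoeff (A i j) (hA i j)).mul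
      (HardyVal.det fun i j => hH₀ i j)
  have hle := hk.enorm_le (p := ENNReal.ofReal (2 / d)) (by simpa using hd)
  have hnorm : eLpNorm (fun x => (Ax x).det *
      (Matrix.of fun i j => pointwiseInner (w i) (u j) x).det) (ENNReal.ofReal (2 / d)) haar =
      eLpNorm (fun x => (Vx x).det) (ENNReal.ofReal (2 / d)) haar := by
    refine eLpNorm_congr_norm_ae ?_
    filter_upwards [hWW, hVA] with x h1 h2
    have h3 : ‖(Wx x).det‖ = 1 := by
      have := congr_arg (fun M => ‖M.det‖) h1
      simp only [Matrix.det_mul, Matrix.det_conjTranspose, norm_mul, norm_star, Matrix.det_one,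
        norm_one] at this
      nlinarith [norm_nonneg (Wx x).det]
    rw [hHx, h2, Matrix.det_mul, Matrix.det_mul, Matrix.det_conjTranspose]
    simp [h3]
  rw [hnorm] at hle
  have hle2 := (ENNReal.rpow_le_rpow hle hd'.le).trans (eLpNorm_det_le hd v)
  rw [← ofReal_norm, ENNReal.ofReal_rpow_of_nonneg (norm_nonneg _) hd'.le,
    ENNReal.ofReal_le_ofReal_iff (by positivity)] at hle2
  rw [evalMatrix_eq_mul hA hu hv hvu, hU0, Matrix.det_mul, Matrix.det_mul, mul_left_comm, norm_mul,
    Real.mul_rpow (norm_nonneg _) (norm_nonneg _)]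
  gcongr

theorem norm_constVec_single (j : Fin d) : ‖constVec (Pi.single j (1 : ℂ) : Fin d → ℂ)‖ = 1 := by
  have h : constVec (Pi.single j (1 : ℂ) : Fin d → ℂ) =
      PiLp.single 2 j (fourierLp (T := 2 * π) 2 0) := by
    ext1 i
    by_cases hij : i = j
    · subst hij; simp [constVec]
    · simp [constVec, hij]
  rw [h, PiLp.norm_single]
  exact orthonormal_fourier.1 0

theorem evalZero_constVec (c : Fin d → ℂ) : evalZero (constVec c) = c := by
  ext i
  rw [evalZero_apply, ← coeffL_apply]
  simp only [constVec, map_smul]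
  rw [coeffL, innerSL_apply_apply, coe_fourierBasis, orthonormal_iff_ite.1 orthonormal_fourier]
  simp

theorem sum_norm_evalZero_le (u : VecL2 d) : ∑ i, ‖evalZero u i‖ ^ 2 ≤ ‖u‖ ^ 2 := by
  rw [PiLp.norm_sq_eq_of_L2]
  refine Finset.sum_le_sum fun i _ => ?_
  rw [evalZero_apply]
  exact (hasSum_norm_fourierCoeff (u i)).summable.le_tsum 0 (fun _ _ => by positivity) |>.trans_eq
    (hasSum_norm_fourierCoeff (u i)).tsum_eq

/-- A function whose norm is attained at the origin is constant. -/
theorem fourierCoeff_eq_zero_of_norm_le (u : VecL2 d) (h : ‖u‖ ^ 2 ≤ ∑ i, ‖evalZero u i‖ ^ 2)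
    (i : Fin d) {n : ℤ} (hn : n ≠ 0) : fourierCoeff (u i) n = 0 := by
  have h1 : ∀ i, ‖evalZero u i‖ ^ 2 ≤ ‖u i‖ ^ 2 := fun i => by
    rw [evalZero_apply]
    exact (hasSum_norm_fourierCoeff (u i)).summable.le_tsum 0 (fun _ _ => by positivity) |>.trans_eq
      (hasSum_norm_fourierCoeff (u i)).tsum_eq
  rw [PiLp.norm_sq_eq_of_L2] at h
  have h2 := (Finset.sum_eq_sum_iff_of_le fun i _ => h1 i).1
    (le_antisymm (Finset.sum_le_sum fun i _ => h1 i) h) i (Finset.mem_univ i)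
  have h3 := (hasSum_norm_fourierCoeff (u i)).summable.sum_le_tsum {0, n} fun _ _ => by positivity
  rw [(hasSum_norm_fourierCoeff (u i)).tsum_eq, Finset.sum_pair hn.symm, ← h2, evalZero_apply] at h3
  have h4 : ‖fourierCoeff (u i) n‖ ^ 2 ≤ 0 := by linarith
  simpa using h4

theorem inner_eq_tsum (u v : Lp ℂ 2 haar) :
    HasSum (fun n => starRingEnd ℂ (fourierCoeff u n) * fourierCoeff v n) (inner ℂ u v) := by
  have h := (fourierBasis (T := 2 * π)).hasSum_inner_mul_inner u v
  convert! h using 2 with n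
  rw [← fourierBasis_repr, ← fourierBasis_repr, HilbertBasis.repr_apply_apply,
    HilbertBasis.repr_apply_apply, inner_conj_symm]

/-- If the image of a shift-invariant space of analytic vector functions under a square
analytic matrix function is dense, then the space itself is dense. -/
theorem mem_closure_of_isAnalytic (hd : 0 < d) (hD : ∀ u ∈ D, IsAnalytic u)
    (hS : ∀ u ∈ D, shift 1 u ∈ D) (hA : ∀ i j, ∀ n < 0, fourierCoeff (A i j) n = 0)
    (hdense : ∀ j, ∀ ε > 0, ∃ u ∈ D, ∃ v : VecL2 d, IsAnalytic v ∧
      (∀ i, v i =ᵐ[haar] fun x => ∑ l, A i l x * u l x) ∧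
      ‖v - constVec (Pi.single j (1 : ℂ))‖ < ε)
    {f : VecL2 d} (hf : IsAnalytic f) : f ∈ D.topologicalClosure := by
  choose u huD v hv hvu hvε using fun (k : ℕ) (j : Fin d) =>
    hdense j (1 / ((k : ℝ) + 1)) (by positivity)
  have hlim : ∀ j, Tendsto (fun k => v k j) atTop (𝓝 (constVec (Pi.single j (1 : ℂ)))) := fun j => by
    rw [tendsto_iff_norm_sub_tendsto_zero]
    exact squeeze_zero (fun _ => norm_nonneg _) (fun k => (hvε k j).le)
      tendsto_one_div_add_atTop_nhds_zero_nat
  have hlimdet : Tendsto (fun k => (evalMatrix (v k)).det) atTop (𝓝 1) := by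
    have hcont : Continuous fun v : Fin d → VecL2 d => (evalMatrix v).det := by
      refine Continuous.matrix_det (continuous_matrix fun i j => ?_)
      exact (continuous_apply i).comp ((evalZero (d := d)).continuous.comp (continuous_apply j))
    have := (hcont.tendsto _).comp (tendsto_pi_nhds.2 hlim)
    convert! this using 2
    rw [← Matrix.det_one (n := Fin d) (R := ℂ)]
    congr 1
    ext i j
    simp [evalMatrix, evalZero_constVec, Matrix.one_apply, Pi.single_apply]
  -- For large `k`, `det V_k(0) = det A(0) det U_k(0)` is nonzero, so the values at the origin of
  -- the columns of `U_k` span `ℂ^d`.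
  have hsurj : ∀ c, ∃ u ∈ D, evalZero u = c := by
    obtain ⟨k, hk⟩ := (hlimdet.eventually_ne one_ne_zero).exists
    rw [evalMatrix_eq_mul hA (fun j => hD _ (huD k j)) (hv k) (hvu k), Matrix.det_mul] at hk
    have hU : IsUnit (evalMatrix (u k)).det := (right_ne_zero_of_mul hk).isUnit
    intro c
    refine ⟨∑ j, ((evalMatrix (u k))⁻¹.mulVec c) j • u k j,
      D.sum_mem fun j _ => D.smul_mem _ (huD k j), ?_⟩
    have : (evalMatrix (u k)).mulVec ((evalMatrix (u k))⁻¹.mulVec c) = c := by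
      rw [Matrix.mulVec_mulVec, Matrix.mul_nonsing_inv _ hU, Matrix.one_mulVec]
    conv_rhs => rw [← this]
    rw [map_sum]
    ext i
    simp [Matrix.mulVec, dotProduct, evalMatrix, mul_comm]
  obtain ⟨w, hw, hwM, hwan⟩ := exists_wandering hD hS hsurj
  have hwa : ∀ j, IsAnalytic (w j) := fun j => isAnalytic_of_mem_closure hD (hwM j)
  have hdR : (d : ℝ) ≠ 0 := by positivity
  have hd' : 0 < (2 / d : ℝ) := by positivity
  -- The determinant estimate in the limit: `det V_k(0) → 1` and the column norms tend to `1`.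
  have hdet : 1 ≤ ‖(evalMatrix w).det‖ ^ (2 / d : ℝ) := by
    have h1 : Tendsto (fun k => ‖(evalMatrix (v k)).det‖ ^ (2 / d : ℝ)) atTop (𝓝 1) := by
      simpa using hlimdet.norm.rpow_const (p := 2 / d) (Or.inr hd'.le)
    have h2 : Tendsto (fun k => ‖(evalMatrix w).det‖ ^ (2 / d : ℝ) *
        ((d : ℝ)⁻¹ * ∑ j, ‖v k j‖ ^ 2)) atTop
        (𝓝 (‖(evalMatrix w).det‖ ^ (2 / d : ℝ) * ((d : ℝ)⁻¹ * ∑ j : Fin d, 1 ^ 2))) := by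
      refine Tendsto.const_mul _ (Tendsto.const_mul _ (tendsto_finsetSum _ fun j _ => ?_))
      rw [← norm_constVec_single j]
      exact (hlim j).norm.pow 2
    simp only [one_pow, Finset.sum_const, Finset.card_univ, Fintype.card_fin, nsmul_eq_mul, mul_one,
      inv_mul_cancel₀ hdR] at h2
    exact le_of_tendsto_of_tendsto' h1 h2 fun k => norm_det_evalMatrix_le hd hA hw hwa
      (fun i j => hwan i _ (hwM j)) (fun j => hD _ (huD k j)) (hv k)
      (fun i j => hwan i _ (D.le_topologicalClosure (huD k j))) (hvu k)
  -- The sum over `j` of the right sides is at least `d` by `norm_det_rpow_le`, and that of the left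
  -- sides is exactly `d`. Since each right side is at most its left side, all are equal.
  have hwnorm : ∀ j, ‖w j‖ ^ 2 ≤ ∑ i, ‖evalZero (w j) i‖ ^ 2 := by
    have h1 := hdet.trans (norm_det_rpow_le hd (evalMatrix w))
    rw [Finset.sum_comm, inv_mul_eq_div, one_le_div (by positivity)] at h1
    have h2 : ∑ j, ‖w j‖ ^ 2 = d := by simp [hw.1]
    have h3 := (Finset.sum_eq_sum_iff_of_le fun j _ => sum_norm_evalZero_le (w j)).1
      (le_antisymm (Finset.sum_le_sum fun j _ => sum_norm_evalZero_le (w j)) (h2.trans_le h1))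
    exact fun j => (h3 j (Finset.mem_univ j)).ge
  have hW0 : (evalMatrix w).det ≠ 0 := by
    intro h0
    rw [h0, norm_zero, Real.zero_rpow hd'.ne'] at hdet
    linarith
  have : CompleteSpace D.topologicalClosure :=
    (Submodule.isClosed_topologicalClosure _).completeSpace_coe
  rw [← Submodule.orthogonal_orthogonal D.topologicalClosure]
  rw [Submodule.mem_orthogonal]
  intro g hg
  -- Each `w j` is constant, so `g ⊥ z^n w_j` involves only the `n`-th coefficient of `g`; letting
  -- `j` vary and using that `W(0)` is invertible kills it.
  have hcoef : ∀ n : ℕ, ∀ i, fourierCoeff (g i) n = 0 := by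
    intro n
    have h1 : Matrix.vecMul (fun i => starRingEnd ℂ (fourierCoeff (g i) n)) (evalMatrix w) = 0 := by
      ext j
      have h2 := Submodule.inner_left_of_mem_orthogonal (shift_mem_closure hS (hwM j) n) hg
      rw [PiLp.inner_apply] at h2
      rw [Matrix.vecMul, dotProduct, Pi.zero_apply, ← h2]
      refine Finset.sum_congr rfl fun i _ => ?_
      have h3 := (inner_eq_tsum (g i) (mulFourier n (w j i))).unique
        (hasSum_single (n : ℤ) fun m hm => by
          rw [fourierCoeff_mulFourier, fourierCoeff_eq_zero_of_norm_le (w j) (hwnorm j) i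
            (sub_ne_zero.2 hm), mul_zero])
      rw [shift_apply, h3, fourierCoeff_mulFourier, sub_self]
      simp only [evalMatrix, Matrix.of_apply, evalZero_apply]
    have h2 := Matrix.eq_zero_of_vecMul_eq_zero hW0 h1
    intro i
    simpa using congr_fun h2 i
  rw [PiLp.inner_apply]
  refine Finset.sum_eq_zero fun i _ => ?_
  refine (inner_eq_tsum (g i) (f i)).unique ?_
  convert! hasSum_zero using 2 with n
  rcases lt_or_ge n 0 with h | h
  · rw [hf i n h, mul_zero]
  · obtain ⟨m, rfl⟩ := Int.eq_ofNat_of_zero_le h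
    rw [hcoef, map_zero, zero_mul]

end

/-! ### `L²` boundary functions of scalar analytic functions. -/

section

variable {f g : ℂ → ℂ} {r : ℝ} {u v : Lp ℂ 2 haar}

theorem mul_fourier_mem_ball (hr : r ∈ Ioo (0 : ℝ) 1) (x : Torus) :
    (r : ℂ) * fourier 1 x ∈ Metric.ball (0 : ℂ) 1 := by
  rw [mem_ball_zero_iff, norm_mul, fourier_one, Circle.norm_coe, mul_one, Complex.norm_real,
    Real.norm_of_nonneg hr.1.le]
  exact hr.2

theorem continuous_dilation {K : Type*} [TopologicalSpace K] {f : ℂ → K}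
    (hf : ContinuousOn f (Metric.ball 0 1)) (hr : r ∈ Ioo (0 : ℝ) 1) :
    Continuous fun x : Torus => f (r * fourier 1 x) :=
  hf.comp_continuous (by fun_prop) (mul_fourier_mem_ball hr)

open Classical in
/-- The function `ζ ↦ f (r ζ)` as an element of `L²` of the circle. -/
def dilation (f : ℂ → ℂ) (r : ℝ) : Lp ℂ 2 haar :=
  if h : MemLp (fun x : Torus => f (r * fourier 1 x)) 2 haar then h.toLp else 0

theorem memLp_dilation (hf : ContinuousOn f (Metric.ball 0 1)) (hr : r ∈ Ioo (0 : ℝ) 1) :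
    MemLp (fun x : Torus => f (r * fourier 1 x)) 2 haar := by
  obtain ⟨C, hC⟩ := isCompact_univ.exists_bound_of_continuousOn
    (continuous_dilation hf hr).continuousOn
  exact MemLp.of_bound (continuous_dilation hf hr).aestronglyMeasurable C
    (Eventually.of_forall fun x => hC x (mem_univ x))

theorem coeFn_dilation (hf : ContinuousOn f (Metric.ball 0 1)) (hr : r ∈ Ioo (0 : ℝ) 1) :
    dilation f r =ᵐ[haar] fun x => f (r * fourier 1 x) := by
  rw [dilation, dif_pos (memLp_dilation hf hr)]
  exact MemLp.coeFn_toLp _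

/-- The Taylor coefficients at the origin, extended by zero to negative indices. -/
def taylorCoeff (f : ℂ → ℂ) (n : ℤ) : ℂ :=
  if 0 ≤ n then (n.toNat.factorial : ℂ)⁻¹ * iteratedDeriv n.toNat f 0 else 0

/-- On the circle of radius `r` the Taylor series converges absolutely in the uniform norm, so
Fourier coefficients can be taken term by term. -/
theorem fourierCoeff_dilation (hf : DifferentiableOn ℂ f (Metric.ball 0 1))
    (hr : r ∈ Ioo (0 : ℝ) 1) (n : ℤ) :
    fourierCoeff (dilation f r) n = taylorCoeff f n * (r : ℂ) ^ n.toNat := by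
  set a : ℕ → ℂ := fun k => (k.factorial : ℂ)⁻¹ * iteratedDeriv k f 0 with ha
  have htaylor : ∀ z ∈ Metric.ball (0 : ℂ) 1, HasSum (fun k => a k * z ^ k) (f z) := fun z hz => by
    convert! Complex.hasSum_taylorSeries_on_ball hf hz using 2 with k
    simp only [ha, sub_zero, smul_eq_mul]
    ring
  have hsum : Summable fun k : ℕ => (a k * (r : ℂ) ^ k) • (fourier (T := 2 * π) (k : ℤ)) := by
    refine Summable.of_norm ?_
    simp only [norm_smul, fourier_norm, mul_one]
    refine (htaylor r ?_).summable.norm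
    rw [mem_ball_zero_iff, Complex.norm_real, Real.norm_of_nonneg hr.1.le]
    exact hr.2
  have h1 : (ContinuousMap.toLp (E := ℂ) 2 haar ℂ
      (∑' k : ℕ, (a k * (r : ℂ) ^ k) • (fourier (T := 2 * π) (k : ℤ)))) = dilation f r := by
    apply Lp.ext
    filter_upwards [coeFn_dilation hf.continuousOn hr, ContinuousMap.coeFn_toLp (p := 2) (𝕜 := ℂ)
      haar (∑' k : ℕ, (a k * (r : ℂ) ^ k) • (fourier (T := 2 * π) (k : ℤ)))] with x h1 h2
    rw [h1, h2]
    refine (ContinuousMap.hasSum_apply hsum.hasSum x).unique ?_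
    convert! htaylor _ (mul_fourier_mem_ball hr x) using 2 with k
    rw [ContinuousMap.smul_apply, fourier_natCast, smul_eq_mul, mul_pow]
    ring
  have h2 := (hsum.hasSum.mapL (ContinuousMap.toLp (E := ℂ) 2 haar ℂ)).mapL (coeffL n)
  rw [h1, coeffL_apply] at h2
  have h3 : ∀ k : ℕ, coeffL n (ContinuousMap.toLp (E := ℂ) 2 haar ℂ
      ((a k * (r : ℂ) ^ k) • (fourier (T := 2 * π) (k : ℤ)))) =
      if n = k then a k * (r : ℂ) ^ k else 0 := fun k => by
    rw [map_smul, map_smul, coeffL, innerSL_apply_apply, coe_fourierBasis]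
    have := orthonormal_iff_ite.1 (orthonormal_fourier (T := 2 * π)) n k
    rw [fourierLp, fourierLp] at this
    rw [fourierLp, this]
    simp
  simp only [h3] at h2
  rw [taylorCoeff]
  split_ifs with hn
  · obtain ⟨m, rfl⟩ := Int.eq_ofNat_of_zero_le hn
    refine h2.unique ?_
    have h4 := hasSum_single (f := fun k : ℕ => if (m : ℤ) = k then a k * (r : ℂ) ^ k else 0) m
      fun k hk => by simp [hk.symm]
    simpa [ha] using h4
  · refine h2.unique ?_
    rw [zero_mul]
    convert! hasSum_zero using 2 with k
    rw [if_neg (by omega)]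

/-- `u` is the boundary function of the analytic function `f`. -/
def Bdry (f : ℂ → ℂ) (u : Lp ℂ 2 haar) : Prop :=
  DifferentiableOn ℂ f (Metric.ball 0 1) ∧ Tendsto (dilation f) (𝓝[<] 1) (𝓝 u)

theorem Ioo_mem_nhdsLT_one : Ioo (0 : ℝ) 1 ∈ 𝓝[<] (1 : ℝ) := Ioo_mem_nhdsLT one_pos

namespace Bdry

theorem congr (hf : Bdry f u) (h : ∀ z ∈ Metric.ball (0 : ℂ) 1, g z = f z) : Bdry g u := by
  have hg : DifferentiableOn ℂ g (Metric.ball 0 1) := hf.1.congr h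
  refine ⟨hg, hf.2.congr' ?_⟩
  filter_upwards [Ioo_mem_nhdsLT_one] with r hr
  apply Lp.ext
  filter_upwards [coeFn_dilation hf.1.continuousOn hr, coeFn_dilation hg.continuousOn hr]
    with x h1 h2
  rw [h1, h2, h _ (mul_fourier_mem_ball hr x)]

theorem add (hf : Bdry f u) (hg : Bdry g v) : Bdry (fun z => f z + g z) (u + v) := by
  refine ⟨hf.1.add hg.1, (hf.2.add hg.2).congr' ?_⟩
  filter_upwards [Ioo_mem_nhdsLT_one] with r hr
  apply Lp.ext
  filter_upwards [coeFn_dilation hf.1.continuousOn hr, coeFn_dilation hg.1.continuousOn hr,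
    coeFn_dilation (hf.1.add hg.1).continuousOn hr, Lp.coeFn_add (dilation f r) (dilation g r)]
    with x h1 h2 h3 h4
  rw [h4, Pi.add_apply, h1, h2]
  exact h3.symm

theorem const_mul (c : ℂ) (hf : Bdry f u) : Bdry (fun z => c * f z) (c • u) := by
  refine ⟨hf.1.const_mul c, (hf.2.const_smul c).congr' ?_⟩
  filter_upwards [Ioo_mem_nhdsLT_one] with r hr
  apply Lp.ext
  filter_upwards [coeFn_dilation hf.1.continuousOn hr,
    coeFn_dilation (hf.1.const_mul c).continuousOn hr, Lp.coeFn_smul c (dilation f r)]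
    with x h1 h2 h3
  rw [h3, Pi.smul_apply, h1, h2, smul_eq_mul]

theorem sub (hf : Bdry f u) (hg : Bdry g v) : Bdry (fun z => f z - g z) (u - v) := by
  have := hf.add (hg.const_mul (-1))
  simpa [sub_eq_add_neg] using this

theorem const (c : ℂ) : Bdry (fun _ => c) (c • fourierLp (T := 2 * π) 2 0) := by
  refine ⟨differentiableOn_const c, tendsto_const_nhds.congr' ?_⟩
  filter_upwards [Ioo_mem_nhdsLT_one] with r hr
  apply Lp.ext
  filter_upwards [coeFn_dilation (f := fun _ => c) continuousOn_const hr,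
    Lp.coeFn_smul c (fourierLp (T := 2 * π) 2 0), coeFn_fourierLp (T := 2 * π) 2 0] with x h1 h2 h3
  rw [h1, h2, Pi.smul_apply, h3, fourier_zero, smul_eq_mul, mul_one]

theorem id_mul (hf : Bdry f u) : Bdry (fun z => z * f z) (mulFourier 1 u) := by
  have hd : DifferentiableOn ℂ (fun z => z * f z) (Metric.ball 0 1) := differentiableOn_id.mul hf.1
  have h1 : Tendsto (fun r : ℝ => (r : ℂ) • mulFourier 1 (dilation f r)) (𝓝[<] 1)
      (𝓝 ((1 : ℂ) • mulFourier 1 u)) := by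
    refine Tendsto.smul ?_ (((mulFourier 1).continuous.tendsto u).comp hf.2)
    exact (Complex.continuous_ofReal.tendsto' 1 1 (by simp)).mono_left nhdsWithin_le_nhds
  rw [one_smul] at h1
  refine ⟨hd, h1.congr' ?_⟩
  filter_upwards [Ioo_mem_nhdsLT_one] with r hr
  apply Lp.ext
  filter_upwards [coeFn_dilation hf.1.continuousOn hr, coeFn_dilation hd.continuousOn hr,
    Lp.coeFn_smul (r : ℂ) (mulFourier 1 (dilation f r)), coeFn_mulFourier 1 (dilation f r)]
    with x h1 h2 h3 h4
  rw [h2, h3, Pi.smul_apply, h4, h1, smul_eq_mul, mul_assoc]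

theorem fourierCoeff_eq (hf : Bdry f u) (n : ℤ) : fourierCoeff u n = taylorCoeff f n := by
  have h1 := ((coeffL n).continuous.tendsto u).comp hf.2
  rw [coeffL_apply] at h1
  refine tendsto_nhds_unique h1 ?_
  have h2 : Tendsto (fun r : ℝ => taylorCoeff f n * (r : ℂ) ^ n.toNat) (𝓝[<] 1)
      (𝓝 (taylorCoeff f n * ((1 : ℝ) : ℂ) ^ n.toNat)) :=
    ((Continuous.tendsto (by fun_prop) 1)).mono_left nhdsWithin_le_nhds
  rw [Complex.ofReal_one, one_pow, mul_one] at h2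
  refine h2.congr' ?_
  filter_upwards [Ioo_mem_nhdsLT_one] with r hr
  rw [Function.comp_apply, coeffL_apply, fourierCoeff_dilation hf.1 hr]

theorem fourierCoeff_eq_zero (hf : Bdry f u) {n : ℤ} (hn : n < 0) : fourierCoeff u n = 0 := by
  rw [hf.fourierCoeff_eq, taylorCoeff, if_neg (not_le.2 hn)]

theorem norm_dilation_le (hf : Bdry f u) (hr : r ∈ Ioo (0 : ℝ) 1) : ‖dilation f r‖ ≤ ‖u‖ := by
  refine (sq_le_sq₀ (norm_nonneg _) (norm_nonneg _)).1 ?_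
  refine hasSum_le (fun n => ?_) (hasSum_norm_fourierCoeff _) (hasSum_norm_fourierCoeff _)
  rw [fourierCoeff_dilation hf.1 hr, hf.fourierCoeff_eq, norm_mul, norm_pow, Complex.norm_real,
    Real.norm_of_nonneg hr.1.le]
  exact pow_le_pow_left₀ (mul_nonneg (norm_nonneg _) (pow_nonneg hr.1.le _))
    (mul_le_of_le_one_right (norm_nonneg _) (pow_le_one₀ hr.1.le hr.2.le)) 2

end Bdry

/-- Parseval bounds each finite sum of `‖a_n r^n‖²` by `C²`; then `r → 1`. -/
theorem summable_taylorCoeff (hf : DifferentiableOn ℂ f (Metric.ball 0 1)) {C : ℝ}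
    (hC : ∀ r ∈ Ioo (0 : ℝ) 1, ‖dilation f r‖ ≤ C) :
    Summable fun n => ‖taylorCoeff f n‖ ^ 2 := by
  refine summable_of_sum_le (c := C ^ 2) (fun _ => by positivity) fun s => ?_
  have h2 : Tendsto (fun r : ℝ => ∑ n ∈ s, ‖taylorCoeff f n * (r : ℂ) ^ n.toNat‖ ^ 2) (𝓝[<] 1)
      (𝓝 (∑ n ∈ s, ‖taylorCoeff f n * ((1 : ℝ) : ℂ) ^ n.toNat‖ ^ 2)) :=
    ((Continuous.tendsto (by fun_prop) 1)).mono_left nhdsWithin_le_nhds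
  simp only [Complex.ofReal_one, one_pow, mul_one] at h2
  refine le_of_tendsto h2 ?_
  filter_upwards [Ioo_mem_nhdsLT_one] with r hr
  have h3 := hasSum_norm_fourierCoeff (dilation f r)
  simp only [fourierCoeff_dilation hf hr] at h3
  refine (sum_le_hasSum s (fun _ _ => by positivity) h3).trans ?_
  gcongr
  exact hC r hr

/-- Bounded means imply the existence of an `L²` boundary function. -/
theorem exists_bdry (hf : DifferentiableOn ℂ f (Metric.ball 0 1)) {C : ℝ}
    (hC : ∀ r ∈ Ioo (0 : ℝ) 1, ‖dilation f r‖ ≤ C) : ∃ u, Bdry f u := by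
  have hs := summable_taylorCoeff hf hC
  have hm : Memℓp (taylorCoeff f) 2 := by
    rw [memℓp_gen_iff (by norm_num)]
    simpa using hs
  set u : Lp ℂ 2 haar := (fourierBasis (T := 2 * π)).repr.symm ⟨taylorCoeff f, hm⟩ with hu
  have huc : ∀ n, fourierCoeff u n = taylorCoeff f n := fun n => by
    rw [← fourierBasis_repr, hu, LinearIsometryEquiv.apply_symm_apply]
  refine ⟨u, hf, ?_⟩
  rw [tendsto_iff_norm_sub_tendsto_zero]
  -- By Parseval this is `∑ ‖a_n (r^n - 1)‖²`, dominated by `∑ ‖a_n‖²`.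
  have hsq : Tendsto (fun r => ‖dilation f r - u‖ ^ 2) (𝓝[<] 1) (𝓝 0) := by
    have h1 : Tendsto (fun r : ℝ => ∑' n : ℤ, ‖taylorCoeff f n * ((r : ℂ) ^ n.toNat - 1)‖ ^ 2)
        (𝓝[<] 1) (𝓝 (∑' _ : ℤ, 0)) := by
      refine tendsto_tsum_of_dominated_convergence hs (fun n => ?_) ?_
      · have : Tendsto (fun r : ℝ => ‖taylorCoeff f n * ((r : ℂ) ^ n.toNat - 1)‖ ^ 2) (𝓝[<] 1)
            (𝓝 (‖taylorCoeff f n * (((1 : ℝ) : ℂ) ^ n.toNat - 1)‖ ^ 2)) :=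
          ((Continuous.tendsto (by fun_prop) 1)).mono_left nhdsWithin_le_nhds
        simpa using this
      · filter_upwards [Ioo_mem_nhdsLT_one] with r hr n
        rw [norm_pow, norm_norm, norm_mul]
        have h1 : ‖(r : ℂ) ^ n.toNat - 1‖ ≤ 1 := by
          have h2 := pow_le_one₀ hr.1.le hr.2.le (n := n.toNat)
          have h3 := pow_nonneg hr.1.le n.toNat
          rw [← Complex.ofReal_pow, ← Complex.ofReal_one, ← Complex.ofReal_sub, Complex.norm_real,
            Real.norm_eq_abs, abs_le]
          constructor <;> linarith
        gcongr
        exact mul_le_of_le_one_right (norm_nonneg _) h1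
    rw [tsum_zero] at h1
    refine h1.congr' ?_
    filter_upwards [Ioo_mem_nhdsLT_one] with r hr
    rw [← (hasSum_norm_fourierCoeff _).tsum_eq]
    refine tsum_congr fun n => ?_
    rw [← coeffL_apply, map_sub, coeffL_apply, coeffL_apply, huc, fourierCoeff_dilation hf hr]
    ring_nf
  simpa using hsq.sqrt

/-- Boundary functions of products. -/
theorem Bdry.eq_sum_mul {ι : Type*} [Fintype ι] {f g : ι → ℂ → ℂ} {u v : ι → Lp ℂ 2 haar}
    {h : ℂ → ℂ} {w : Lp ℂ 2 haar} (hf : ∀ l, Bdry (f l) (u l)) (hg : ∀ l, Bdry (g l) (v l))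
    (hh : Bdry h w) (heq : ∀ z ∈ Metric.ball (0 : ℂ) 1, h z = ∑ l, f l z * g l z) :
    w =ᵐ[haar] fun x => ∑ l, u l x * v l x := by
  have hlim : ∀ {f : ℂ → ℂ} {u : Lp ℂ 2 haar}, Bdry f u →
      Tendsto (fun r => eLpNorm (fun x => dilation f r x - u x) 2 haar) (𝓝[<] 1) (𝓝 0) := by
    intro f u hf
    have h1 := ENNReal.tendsto_ofReal (tendsto_iff_norm_sub_tendsto_zero.1 hf.2)
    rw [ENNReal.ofReal_zero] at h1
    refine h1.congr fun r => ?_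
    rw [ofReal_norm, Lp.enorm_def]
    exact eLpNorm_congr_ae (Lp.coeFn_sub _ _)
  have hsm : ∀ u : Lp ℂ 2 haar, AEStronglyMeasurable u haar := fun u => (Lp.memLp u).1
  have hprod : ∀ l, Tendsto (fun r => eLpNorm (fun x => dilation (f l) r x * dilation (g l) r x -
      u l x * v l x) 1 haar) (𝓝[<] 1) (𝓝 0) := fun l =>
    tendsto_eLpNorm_mul_sub (p := 2) (q := 2) (fun r => hsm _) (fun r => hsm _) (Lp.memLp (u l)) (Lp.memLp (v l))
      (hlim (hf l)) (hlim (hg l))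
  have hsmm : ∀ (u v : Lp ℂ 2 haar), AEStronglyMeasurable (fun x => u x * v x) haar :=
    fun u v => (hsm u).mul (hsm v)
  have hsum : ∀ s : Finset ι, Tendsto (fun r => eLpNorm (fun x =>
      ∑ l ∈ s, dilation (f l) r x * dilation (g l) r x - ∑ l ∈ s, u l x * v l x) 1 haar)
      (𝓝[<] 1) (𝓝 0) := by
    classical
    intro s
    induction s using Finset.induction_on with
    | empty => simp
    | insert i s hi ih =>
      simp only [Finset.sum_insert hi]
      exact tendsto_eLpNorm_add_sub (fun r => hsmm _ _)
        (fun r => Finset.aestronglyMeasurable_fun_sum s fun l _ => hsmm _ _) (hsmm _ _)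
        (Finset.aestronglyMeasurable_fun_sum s fun l _ => hsmm _ _) (hprod i) ih
  have hS : AEStronglyMeasurable (fun x => ∑ l, u l x * v l x) haar :=
    Finset.aestronglyMeasurable_fun_sum _ fun l _ => hsmm _ _
  have hfin : Tendsto (fun r => eLpNorm (fun x => dilation h r x - w x) 2 haar +
      eLpNorm (fun x => ∑ l, dilation (f l) r x * dilation (g l) r x -
        ∑ l, u l x * v l x) 1 haar) (𝓝[<] 1) (𝓝 (0 + 0)) := (hlim hh).add (hsum Finset.univ)
  -- Products of `L²` limits converge only in `L¹`, so the comparison is made there.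
  have hzero : eLpNorm (fun x => w x - ∑ l, u l x * v l x) 1 haar = 0 := by
    rw [add_zero] at hfin
    refine nonpos_iff_eq_zero.1 (ge_of_tendsto hfin ?_)
    filter_upwards [Ioo_mem_nhdsLT_one] with r hr
    have h1 : dilation h r =ᵐ[haar] fun x => ∑ l, dilation (f l) r x * dilation (g l) r x := by
      filter_upwards [coeFn_dilation hh.1.continuousOn hr,
        ae_all_iff.2 fun l => coeFn_dilation (hf l).1.continuousOn hr,
        ae_all_iff.2 fun l => coeFn_dilation (hg l).1.continuousOn hr] with x h1 h2 h3
      rw [h1, heq _ (mul_fourier_mem_ball hr x)]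
      simp only [h2, h3]
    have h2 : (fun x => w x - ∑ l, u l x * v l x) =ᵐ[haar]
        (fun x => ∑ l, dilation (f l) r x * dilation (g l) r x - ∑ l, u l x * v l x) -
          fun x => dilation h r x - w x := by
      filter_upwards [h1] with x hx
      rw [Pi.sub_apply, hx]
      ring
    rw [eLpNorm_congr_ae h2, add_comm]
    have hm₁ : AEStronglyMeasurable (fun x => ∑ l, dilation (f l) r x * dilation (g l) r x -
        ∑ l, u l x * v l x) haar :=
      (Finset.aestronglyMeasurable_fun_sum _ fun l _ => hsmm _ _).sub hS
    have hm₂ : AEStronglyMeasurable (fun x => dilation h r x - w x) haar := (hsm _).sub (hsm _)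
    refine (eLpNorm_sub_le hm₁ hm₂ le_rfl).trans ?_
    gcongr
    exact eLpNorm_le_eLpNorm_of_exponent_le one_le_two hm₂
  have := (eLpNorm_eq_zero_iff ((hsm w).sub hS) one_ne_zero).1 hzero
  filter_upwards [this] with x hx
  exact sub_eq_zero.1 hx

end

/-! ### Transposition, vector-valued Hardy classes, and the reduction to boundary functions. -/

section

section Transpose

variable {ι κ μ H K L : Type*} [NormedAddCommGroup H] [InnerProductSpace ℂ H]
  [NormedAddCommGroup K] [InnerProductSpace ℂ K] [NormedAddCommGroup L] [InnerProductSpace ℂ L]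

theorem inner_conjugation_right (b : HilbertBasis ι ℂ H) (x y : H) :
    inner ℂ y (conjugation b x) = inner ℂ x (conjugation b y) := by
  have h : ∀ x y, inner ℂ y (conjugation b x) = inner ℂ (b.repr y) (starₗᵢ ℂ (b.repr x)) := by
    intro x y
    rw [← b.repr.inner_map_map]
    simp [conjugation]
  rw [h, h, lp.inner_eq_tsum, lp.inner_eq_tsum]
  refine tsum_congr fun i => ?_
  simp [mul_comm]

theorem inner_conjugation_left (b : HilbertBasis ι ℂ H) (x y : H) :
    inner ℂ (conjugation b x) y = inner ℂ (conjugation b y) x := by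
  rw [← inner_conj_symm, inner_conjugation_right, inner_conj_symm]

theorem conjugation_conjugation (b : HilbertBasis ι ℂ H) (x : H) :
    conjugation b (conjugation b x) = x := by
  simp [conjugation]

variable [CompleteSpace H] [CompleteSpace K]

theorem inner_transpose_apply (b : HilbertBasis ι ℂ H) (b' : HilbertBasis κ ℂ K) (T : H →L[ℂ] K)
    (x : K) (y : H) :
    inner ℂ y (transpose b b' T x) = inner ℂ (conjugation b' x) (T (conjugation b y)) := by
  have h : transpose b b' T x =
      conjugation b (ContinuousLinearMap.adjoint T (conjugation b' x)) := rfl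
  rw [h, inner_conjugation_right, ContinuousLinearMap.adjoint_inner_left]

theorem transpose_comp [CompleteSpace L] (b : HilbertBasis ι ℂ H) (b' : HilbertBasis κ ℂ K)
    (b'' : HilbertBasis μ ℂ L) (S : K →L[ℂ] L) (T : H →L[ℂ] K) :
    transpose b b'' (S.comp T) = (transpose b b' T).comp (transpose b' b'' S) := by
  ext x
  refine ext_inner_left ℂ fun y => ?_
  rw [inner_transpose_apply, ContinuousLinearMap.comp_apply, ContinuousLinearMap.comp_apply,
    inner_transpose_apply, inner_conjugation_left b', inner_transpose_apply, conjugation_conjugation]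

/-- Transposition as a bounded linear map. -/
def transposeL (b : HilbertBasis ι ℂ H) (b' : HilbertBasis κ ℂ K) :
    (H →L[ℂ] K) →L[ℂ] (K →L[ℂ] H) :=
  LinearMap.mkContinuous
    { toFun := transpose b b'
      map_add' := fun S T => by
        ext x
        refine ext_inner_left ℂ fun y => ?_
        simp only [inner_transpose_apply, _root_.add_apply, inner_add_right]
      map_smul' := fun c T => by
        ext x
        refine ext_inner_left ℂ fun y => ?_
        simp only [inner_transpose_apply, _root_.smul_apply, inner_smul_right,
          RingHom.id_apply] }
    1 fun T => by
      refine ContinuousLinearMap.opNorm_le_bound _ (by positivity) fun x => ?_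
      have h : transpose b b' T x =
        conjugation b (ContinuousLinearMap.adjoint T (conjugation b' x)) := rfl
      change ‖transpose b b' T x‖ ≤ _
      rw [h, LinearIsometryEquiv.norm_map, one_mul]
      refine (ContinuousLinearMap.le_opNorm _ _).trans_eq ?_
      rw [LinearIsometryEquiv.norm_map, LinearIsometryEquiv.norm_map]

end Transpose

section MemH2

variable {H K L : Type*} [NormedAddCommGroup H] [InnerProductSpace ℂ H]
  [NormedAddCommGroup K] [InnerProductSpace ℂ K] [NormedAddCommGroup L] [InnerProductSpace ℂ L]

theorem circleMap_mem_unitBall {r : ℝ} (hr : r ∈ Ioo (0 : ℝ) 1) (t : ℝ) :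
    circleMap 0 r t ∈ Metric.ball (0 : ℂ) 1 := by
  rw [circleMap_eq_fourier]
  exact mul_fourier_mem_ball hr _

theorem continuous_circleMap_comp {f : ℂ → K} (hf : DifferentiableOn ℂ f (Metric.ball 0 1)) {r : ℝ}
    (hr : r ∈ Ioo (0 : ℝ) 1) : Continuous fun t : ℝ => f (circleMap 0 r t) :=
  hf.continuousOn.comp_continuous (continuous_circleMap 0 r) (circleMap_mem_unitBall hr)

theorem eLpNorm_le_h2Norm {K : Type*} [NormedAddCommGroup K] (f : ℂ → K) {r : ℝ} (hr : r ∈ Ioo (0 : ℝ) 1) :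
    eLpNorm (fun t : ℝ => f (circleMap 0 r t)) 2 circleMeasure ≤ h2Norm f :=
  le_iSup₂ (f := fun r (_ : r ∈ Ioo (0 : ℝ) 1) =>
    eLpNorm (fun t : ℝ => f (circleMap 0 r t)) 2 circleMeasure) r hr

theorem MemH2.of_le {f : ℂ → K} {g : ℂ → L} (hf : MemH2 f)
    (hg : DifferentiableOn ℂ g (Metric.ball 0 1)) (C : ℝ)
    (h : ∀ z ∈ Metric.ball (0 : ℂ) 1, ‖g z‖ ≤ C * ‖f z‖) : MemH2 g := by
  refine ⟨hg, lt_of_le_of_lt (b := ENNReal.ofReal C * h2Norm f) (iSup₂_le fun r hr => ?_)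
    (ENNReal.mul_lt_top ENNReal.ofReal_lt_top hf.2)⟩
  refine (eLpNorm_le_mul_eLpNorm_of_ae_le_mul
    (Eventually.of_forall fun t => h _ (circleMap_mem_unitBall hr t)) 2).trans ?_
  gcongr
  exact eLpNorm_le_h2Norm f hr

theorem MemH2.add {f g : ℂ → K} (hf : MemH2 f) (hg : MemH2 g) : MemH2 fun z => f z + g z := by
  refine ⟨hf.1.add hg.1, lt_of_le_of_lt (iSup₂_le fun r hr => ?_)
    (ENNReal.add_lt_top.2 ⟨hf.2, hg.2⟩)⟩
  refine (eLpNorm_add_le (continuous_circleMap_comp hf.1 hr).aestronglyMeasurable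
    (continuous_circleMap_comp hg.1 hr).aestronglyMeasurable one_le_two).trans ?_
  gcongr
  · exact eLpNorm_le_h2Norm f hr
  · exact eLpNorm_le_h2Norm g hr

theorem MemH2.const (c : K) : MemH2 fun _ => c := by
  refine ⟨differentiableOn_const c, lt_of_le_of_lt (b := ‖c‖ₑ) (iSup₂_le fun r _ => ?_) (by simp)⟩
  rw [eLpNorm_const c two_ne_zero (IsProbabilityMeasure.ne_zero _)]
  simp

theorem MemH2.sum {ι : Type*} (s : Finset ι) {f : ι → ℂ → K} (hf : ∀ i ∈ s, MemH2 (f i)) :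
    MemH2 fun z => ∑ i ∈ s, f i z := by
  classical
  induction s using Finset.induction_on with
  | empty => simpa using MemH2.const (0 : K)
  | insert i s hi ih =>
    simp only [Finset.sum_insert hi]
    exact (hf i (by simp)).add (ih fun j hj => hf j (by simp [hj]))

theorem MemH2.pow_smul {f : ℂ → K} (hf : MemH2 f) (n : ℕ) : MemH2 fun z => z ^ n • f z := by
  refine hf.of_le ((differentiableOn_id.pow n).smul hf.1) 1 fun z hz => ?_
  rw [norm_smul, norm_pow]
  gcongr
  exact pow_le_one₀ (norm_nonneg _) (mem_ball_zero_iff.1 hz).le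

theorem MemH2s.memH2_poly {F : ℂ → H →L[ℂ] K} (hF : MemH2s F) {q : ℂ → H} (hq : IsPoly q) :
    MemH2 fun z => F z (q z) := by
  obtain ⟨N, c, hq⟩ := hq
  simp only [hq, map_sum, map_smul]
  exact MemH2.sum _ fun n _ => (hF.2 (c n)).pow_smul n

theorem MemH2.inner_left {f : ℂ → K} (hf : MemH2 f) (y : K) : MemH2 fun z => inner ℂ y (f z) :=
  hf.of_le ((innerSL ℂ y).differentiable.comp_differentiableOn hf.1) ‖y‖
    fun z _ => norm_inner_le_norm y (f z)

theorem MemH2.of_components {d : ℕ} (c : OrthonormalBasis (Fin d) ℂ K) {f : ℂ → K}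
    (hf : ∀ i, MemH2 fun z => inner ℂ (c i) (f z)) : MemH2 f := by
  have h : MemH2 fun z => ∑ i, (inner ℂ (c i) (f z) : ℂ) • c i := by
    refine MemH2.sum _ fun i _ => (hf i).of_le ((hf i).1.smul_const (c i)) 1 fun z _ => ?_
    rw [norm_smul, c.norm_eq_one, mul_one, one_mul]
  simpa only [c.sum_repr'] using h

/-- The mean value property on the circle of radius `1/2`, an arbitrary choice; it makes evaluation
at the origin continuous. -/
theorem enorm_apply_zero_le_h2Norm [CompleteSpace K] {f : ℂ → K}
    (hf : DifferentiableOn ℂ f (Metric.ball 0 1)) : ‖f 0‖ₑ ≤ h2Norm f := by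
  have hr : (1 / 2 : ℝ) ∈ Ioo (0 : ℝ) 1 := by norm_num
  have hmean : f 0 = ∫ t, f (circleMap 0 (1 / 2) t) ∂circleMeasure := by
    have hsub : Metric.closedBall (0 : ℂ) (1 / 2) ⊆ Metric.ball 0 1 :=
      Metric.closedBall_subset_ball hr.2
    have h := DiffContOnCl.circleAverage (f := f) (c := 0) (R := 1 / 2)
      (DifferentiableOn.diffContOnCl (hf.mono (by
        rw [abs_of_pos hr.1, closure_ball _ (by norm_num)]
        exact hsub)))
    rw [← h, Real.circleAverage_def, circleMeasure, integral_smul_measure,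
      intervalIntegral.integral_of_le two_pi_pos.le, ENNReal.toReal_inv,
      ENNReal.toReal_ofReal two_pi_pos.le]
  have hm := (continuous_circleMap_comp hf hr).aestronglyMeasurable (μ := circleMeasure)
  rw [hmean]
  refine (enorm_integral_le_lintegral_enorm _).trans ?_
  rw [← eLpNorm_one_eq_lintegral_enorm]
  exact (eLpNorm_le_eLpNorm_of_exponent_le one_le_two hm).trans (eLpNorm_le_h2Norm f hr)

theorem MemH2.exists_bdry {f : ℂ → ℂ} (hf : MemH2 f) : ∃ u, Bdry f u := by
  refine OpHardy.exists_bdry hf.1 (C := (h2Norm f).toReal) fun r hr => ?_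
  rw [Lp.norm_def]
  refine ENNReal.toReal_mono hf.2.ne ?_
  rw [eLpNorm_congr_ae (coeFn_dilation hf.1.continuousOn hr), ← eLpNorm_circleMap f 2 r
    (continuous_dilation hf.1.continuousOn hr).aestronglyMeasurable]
  exact eLpNorm_le_h2Norm f hr

/-- The Hardy norm is the `L²` norm of the boundary function. -/
theorem h2Norm_eq_enorm {d : ℕ} (c : OrthonormalBasis (Fin d) ℂ K) {f : ℂ → K} {u : VecL2 d}
    (hf : ∀ i, Bdry (fun z => inner ℂ (c i) (f z)) (u i)) : h2Norm f = ‖u‖ₑ := by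
  set U : ℝ → VecL2 d := fun r => WithLp.toLp 2 fun i => dilation (fun z => inner ℂ (c i) (f z)) r
    with hU
  have hfd : DifferentiableOn ℂ f (Metric.ball 0 1) := by
    have h : DifferentiableOn ℂ (fun z => ∑ i, (inner ℂ (c i) (f z) : ℂ) • c i)
        (Metric.ball 0 1) := DifferentiableOn.fun_sum fun i _ => (hf i).1.smul_const (c i)
    simpa only [c.sum_repr'] using h
  have hnorm : ∀ r ∈ Ioo (0 : ℝ) 1,
      eLpNorm (fun t : ℝ => f (circleMap 0 r t)) 2 circleMeasure = ‖U r‖ₑ := fun r hr => by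
    have hc := continuous_dilation hfd.continuousOn hr
    rw [eLpNorm_circleMap f 2 r hc.aestronglyMeasurable, ← ofReal_norm]
    have hm : MemLp (fun x : Torus => f (r * fourier 1 x)) 2 haar := by
      obtain ⟨C, hC⟩ := isCompact_univ.exists_bound_of_continuousOn hc.continuousOn
      exact MemLp.of_bound hc.aestronglyMeasurable C (Eventually.of_forall fun x => hC x (mem_univ x))
    rw [hm.eLpNorm_eq_integral_rpow_norm two_ne_zero ENNReal.ofNat_ne_top]
    congr 1
    have h2 : ∫ x, ‖f (r * fourier 1 x)‖ ^ (2 : ℝ≥0∞).toReal ∂haar = ‖U r‖ ^ 2 := by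
      rw [PiLp.norm_sq_eq_of_L2]
      simp only [← integral_norm_sq]
      rw [← integral_finsetSum]
      · refine integral_congr_ae ?_
        filter_upwards [ae_all_iff.2 fun i => coeFn_dilation (hf i).1.continuousOn hr] with x hx
        simp only [hU, hx, ENNReal.toReal_ofNat, Real.rpow_two, c.sum_sq_norm_inner_right]
      · intro i _
        simpa using (Lp.memLp (U r i)).integrable_norm_pow (p := 2) (by norm_num)
    rw [h2, ENNReal.toReal_ofNat, ← Real.rpow_natCast, Nat.cast_ofNat,
      Real.rpow_rpow_inv (norm_nonneg _) two_ne_zero]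
  have hle : ∀ r ∈ Ioo (0 : ℝ) 1, ‖U r‖ₑ ≤ ‖u‖ₑ := fun r hr => by
    rw [enorm_le_iff_norm_le, ← sq_le_sq₀ (norm_nonneg _) (norm_nonneg _),
      PiLp.norm_sq_eq_of_L2, PiLp.norm_sq_eq_of_L2]
    gcongr with i
    exact (hf i).norm_dilation_le hr
  have hlim : Tendsto U (𝓝[<] 1) (𝓝 u) :=
    ((PiLp.continuous_toLp 2 _).tendsto _).comp (tendsto_pi_nhds.2 fun i => (hf i).2)
  refine le_antisymm (iSup₂_le fun r hr => (hnorm r hr).trans_le (hle r hr)) ?_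
  refine le_of_tendsto hlim.enorm ?_
  filter_upwards [Ioo_mem_nhdsLT_one] with r hr
  rw [← hnorm r hr]
  exact eLpNorm_le_h2Norm f hr

/-- Approximate the constant function `y` by some `F q` and evaluate at the origin. -/
theorem IsOuter.denseRange [CompleteSpace K] {F : ℂ → H →L[ℂ] K} (hF : IsOuter F) :
    DenseRange (F 0) := by
  intro y
  refine EMetric.mem_closure_iff.2 fun ε hε => ?_
  obtain ⟨q, hq, hlt⟩ := hF.2 (fun _ => y) (MemH2.const y) ε hε
  refine ⟨F 0 (q 0), mem_range_self _, ?_⟩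
  rw [edist_comm, edist_eq_enorm_sub]
  exact (enorm_apply_zero_le_h2Norm (f := fun z => F z (q z) - y)
    ((hF.1.memH2_poly hq).1.sub (differentiableOn_const y))).trans_lt hlt

theorem IsOuter.range_eq_top [CompleteSpace K] {F : ℂ → H →L[ℂ] K} (hF : IsOuter F)
    (hfin : FiniteDimensional ℂ (F 0).toLinearMap.range) : (F 0).toLinearMap.range = ⊤ := by
  have h1 : IsClosed ((F 0).toLinearMap.range : Set K) := Submodule.closed_of_finiteDimensional _
  rw [← SetLike.coe_set_eq, ← h1.closure_eq]
  exact hF.denseRange.closure_eq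

theorem IsPoly.add {p q : ℂ → H} (hp : IsPoly p) (hq : IsPoly q) : IsPoly fun z => p z + q z := by
  obtain ⟨N, a, hp⟩ := hp
  obtain ⟨M, c, hq⟩ := hq
  refine ⟨max N M, fun n => (if n < N then a n else 0) + (if n < M then c n else 0), fun z => ?_⟩
  simp only [smul_add, Finset.sum_add_distrib, smul_ite, smul_zero, ← Finset.sum_filter, hp, hq]
  congr 1
  · refine Finset.sum_congr ?_ fun _ _ => rfl
    ext n; simp; omega
  · refine Finset.sum_congr ?_ fun _ _ => rfl
    ext n; simp; omega

theorem IsPoly.const_smul {q : ℂ → H} (hq : IsPoly q) (a : ℂ) : IsPoly fun z => a • q z := by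
  obtain ⟨N, c, hq⟩ := hq
  exact ⟨N, fun n => a • c n, fun z => by simp only [hq, Finset.smul_sum, smul_comm a]⟩

theorem IsPoly.id_smul {q : ℂ → H} (hq : IsPoly q) : IsPoly fun z => z • q z := by
  obtain ⟨N, c, hq⟩ := hq
  refine ⟨N + 1, fun n => if n = 0 then 0 else c (n - 1), fun z => ?_⟩
  simp [Finset.sum_range_succ', hq, Finset.smul_sum, smul_smul, pow_succ']

theorem isPoly_zero : IsPoly fun _ => (0 : H) := ⟨0, 0, fun _ => by simp⟩

/-- The boundary functions of `F q`, with `q` a polynomial, in the coordinates of an orthonormal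
basis. -/
def polyRange {d : ℕ} (F : ℂ → H →L[ℂ] K) (c : OrthonormalBasis (Fin d) ℂ K) :
    Submodule ℂ (VecL2 d) where
  carrier := {u | ∃ q, IsPoly q ∧ ∀ i, Bdry (fun z => inner ℂ (c i) (F z (q z))) (u i)}
  add_mem' := by
    rintro u v ⟨p, hp, hu⟩ ⟨q, hq, hv⟩
    exact ⟨_, hp.add hq, fun i => ((hu i).add (hv i)).congr fun z _ => by
      rw [map_add, inner_add_right]⟩
  zero_mem' := ⟨_, isPoly_zero, fun i => by simpa using Bdry.const 0⟩
  smul_mem' := by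
    rintro a u ⟨q, hq, hu⟩
    exact ⟨_, hq.const_smul a, fun i => ((hu i).const_mul a).congr fun z _ => by
      rw [map_smul, inner_smul_right]⟩

theorem shift_mem_polyRange {d : ℕ} {F : ℂ → H →L[ℂ] K} {c : OrthonormalBasis (Fin d) ℂ K}
    {u : VecL2 d} (hu : u ∈ polyRange F c) : shift 1 u ∈ polyRange F c := by
  obtain ⟨q, hq, hu⟩ := hu
  exact ⟨_, hq.id_smul, fun i => (hu i).id_mul.congr fun z _ => by
    rw [map_smul, inner_smul_right]⟩

theorem MemH2.exists_vecL2 {d : ℕ} (c : OrthonormalBasis (Fin d) ℂ K) {f : ℂ → K} (hf : MemH2 f) :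
    ∃ u : VecL2 d, ∀ i, Bdry (fun z => inner ℂ (c i) (f z)) (u i) := by
  choose u hu using fun i => (hf.inner_left (c i)).exists_bdry
  exact ⟨WithLp.toLp 2 u, hu⟩

/-- If the product of a square analytic matrix function and `B` is outer, then `B` is outer. -/
theorem isOuter_of_mul {d : ℕ} (hd : 0 < d) {K' : Type*} [NormedAddCommGroup K']
    [InnerProductSpace ℂ K'] (c : OrthonormalBasis (Fin d) ℂ K) (e : OrthonormalBasis (Fin d) ℂ K')
    {A : ℂ → K →L[ℂ] K'} {B : ℂ → H →L[ℂ] K} {F : ℂ → H →L[ℂ] K'} (hF : IsOuter F)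
    (hA : ∀ i j, MemH2 fun z => inner ℂ (e i) (A z (c j))) (hB : MemH2s B)
    (hFAB : ∀ z ∈ Metric.ball (0 : ℂ) 1, F z = (A z).comp (B z)) : IsOuter B := by
  refine ⟨hB, fun f hf ε hε => ?_⟩
  choose a ha using fun i j => (hA i j).exists_bdry
  obtain ⟨v, hv⟩ := hf.exists_vecL2 c
  have hmem : v ∈ (polyRange B c).topologicalClosure := by
    refine mem_closure_of_isAnalytic (A := a) hd ?_ (fun u hu => shift_mem_polyRange hu)
      (fun i j n hn => (ha i j).fourierCoeff_eq_zero hn) (fun j δ hδ => ?_)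
      fun i n hn => (hv i).fourierCoeff_eq_zero hn
    · rintro u ⟨q, -, hu⟩ i n hn
      exact (hu i).fourierCoeff_eq_zero hn
    · obtain ⟨q, hq, hlt⟩ := hF.2 (fun _ => e j) (MemH2.const _) (ENNReal.ofReal δ) (by simpa using hδ)
      obtain ⟨u, hu⟩ := (hB.memH2_poly hq).exists_vecL2 c
      obtain ⟨w, hw⟩ := (hF.1.memH2_poly hq).exists_vecL2 e
      refine ⟨u, ⟨q, hq, hu⟩, w, fun i n hn => (hw i).fourierCoeff_eq_zero hn, fun i => ?_, ?_⟩
      · refine Bdry.eq_sum_mul (fun l => ha i l) (fun l => hu l) (hw i) fun z hz => ?_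
        rw [hFAB z hz, ContinuousLinearMap.comp_apply]
        conv_lhs => rw [← c.sum_repr' (B z (q z))]
        rw [map_sum, inner_sum]
        refine Finset.sum_congr rfl fun l _ => ?_
        rw [map_smul, inner_smul_right, mul_comm]
      · have h : h2Norm (fun z => F z (q z) - e j) = ‖w - constVec (Pi.single j (1 : ℂ))‖ₑ := by
          refine h2Norm_eq_enorm e fun i => ?_
          have hi : (w - constVec (Pi.single j (1 : ℂ))) i =
              w i - (Pi.single j (1 : ℂ) : Fin d → ℂ) i • fourierLp (T := 2 * π) 2 0 := rfl
          rw [hi]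
          refine ((hw i).sub (Bdry.const ((Pi.single j (1 : ℂ) : Fin d → ℂ) i))).congr fun z _ => ?_
          rw [inner_sub_right, orthonormal_iff_ite.1 e.orthonormal, Pi.single_apply]
        rw [h, ← ofReal_norm] at hlt
        exact (ENNReal.ofReal_lt_ofReal_iff hδ).1 hlt
  obtain ⟨u, ⟨q, hq, hu⟩, hlt⟩ := EMetric.mem_closure_iff.1 hmem ε hε
  refine ⟨q, hq, ?_⟩
  rw [h2Norm_eq_enorm c (u := u - v) fun i => ((hu i).sub (hv i)).congr fun z _ => by
    rw [inner_sub_right], ← edist_eq_enorm_sub, edist_comm]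
  exact hlt

end MemH2

/-- The values of the transpose lie in a finite-dimensional space, so membership can be tested on
coordinates. Each coordinate is a scalar coefficient of `F` applied to a fixed vector. -/
theorem MemH2s.transpose_of_finiteDimensional {ι κ H K : Type*} [NormedAddCommGroup H]
    [InnerProductSpace ℂ H] [CompleteSpace H] [FiniteDimensional ℂ H] [NormedAddCommGroup K]
    [InnerProductSpace ℂ K] [CompleteSpace K] {F : ℂ → H →L[ℂ] K} (hF : MemH2s F)
    (b : HilbertBasis ι ℂ H) (b' : HilbertBasis κ ℂ K) :
    MemH2s fun z => OpHardy.transpose b b' (F z) := by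
  refine ⟨(transposeL b b').differentiable.comp_differentiableOn hF.1, fun x => ?_⟩
  refine MemH2.of_components (stdOrthonormalBasis ℂ H) fun i => ?_
  simp only [inner_transpose_apply]
  exact (hF.2 _).inner_left _

end

end OpHardy

end

theorem theorem2p1 (d : ℕ)
    (F : ℂ → EuclideanSpace ℂ (Fin d) →L[ℂ] ℓ²(ℕ, ℂ))
    (hF : OpHardy.MemH2s F)
    (hFco : OpHardy.IsCoOuter (OpHardy.stdBasisFin d) OpHardy.stdBasisEll2 F)
    {E : Type*} [NormedAddCommGroup E] [InnerProductSpace ℂ E] [CompleteSpace E]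
    [TopologicalSpace.SeparableSpace E]
    {κ : Type*} (b : HilbertBasis κ ℂ E)
    (Θ : ℂ → E →L[ℂ] ℓ²(ℕ, ℂ)) (G : ℂ → EuclideanSpace ℂ (Fin d) →L[ℂ] E)
    (hΘ : OpHardy.IsInner Θ) (hG : OpHardy.IsOuter G)
    (hfac : ∀ z ∈ Metric.ball (0 : ℂ) 1, F z = (Θ z).comp (G z)) :
    OpHardy.IsCoOuter b OpHardy.stdBasisEll2 Θ := by
  have hGtop := hG.range_eq_top (LinearMap.finiteDimensional_range _)
  have hfinE : FiniteDimensional ℂ E :=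
    Module.Finite.of_surjective _ (LinearMap.range_eq_top.1 hGtop)
  have hFt : ∀ z ∈ Metric.ball (0 : ℂ) 1,
      OpHardy.transpose (OpHardy.stdBasisFin d) OpHardy.stdBasisEll2 (F z) =
        (OpHardy.transpose (OpHardy.stdBasisFin d) b (G z)).comp
          (OpHardy.transpose b OpHardy.stdBasisEll2 (Θ z)) := fun z hz => by
    rw [hfac z hz, OpHardy.transpose_comp _ b]
  have hle : Module.finrank ℂ E ≤ d := by
    have := LinearMap.finrank_le_finrank_of_surjective (LinearMap.range_eq_top.1 hGtop)
    simpa using this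
  -- `Fᵗ(0)` is onto `ℂ^d` and factors as `Gᵗ(0) Θᵗ(0)`, so `Gᵗ(0)`, defined on `E`, is onto.
  have hge : d ≤ Module.finrank ℂ E := by
    have h1 := OpHardy.IsOuter.range_eq_top hFco inferInstance
    rw [LinearMap.range_eq_top] at h1
    have h2 : Function.Surjective
        (OpHardy.transpose (OpHardy.stdBasisFin d) b (G 0)).toLinearMap := fun y => by
      obtain ⟨x, hx⟩ := h1 y
      refine ⟨OpHardy.transpose b OpHardy.stdBasisEll2 (Θ 0) x, ?_⟩
      rw [← hx]
      simp [hFt 0 (by simp)]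
    simpa using LinearMap.finrank_le_finrank_of_surjective h2
  have hB := hΘ.1.transpose_of_finiteDimensional b OpHardy.stdBasisEll2
  -- The exponent `2/d` of the main argument needs `d > 0`; for `d = 0` the space `E` is trivial.
  rcases Nat.eq_zero_or_pos d with rfl | hd
  · have : Subsingleton E := Module.finrank_zero_iff.1 (Nat.le_zero.1 hle)
    refine ⟨hB, fun f _ ε hε => ⟨_, OpHardy.isPoly_zero, ?_⟩⟩
    simpa [OpHardy.h2Norm, Subsingleton.elim _ (0 : E)] using hε
  · refine OpHardy.isOuter_of_mul hd
      ((stdOrthonormalBasis ℂ E).reindex (finCongr (le_antisymm hle hge)))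
      (EuclideanSpace.basisFun (Fin d) ℂ) hFco (fun i j => ?_) hB hFt
    simp only [OpHardy.inner_transpose_apply]
    exact (hG.1.2 _).inner_left _
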